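/- Let $(\mathbb K,|\cdot|)$ be a complete ultrametric field, i.e. a field with a non-trivial absolute value satisfying the ultrametric inequality and complete for the induced metric, and let $E$ be a Hausdorff topological $\mathbb K$-vector space which is locally convex: the open submodules of $E$ over $\{z\in\mathbb K:|z|\le 1\}$ form a basis of $0$-neighbourhoods. **Definitions.** Let $n\ge 1$. A set $U\subseteq\mathbb K^n$ is *cartesian* if $U=U_1\times\cdots\times U_n$ with sets $U_i\subseteq\mathbb K$ without isolated points, and *locally cartesian* if each point of $U$ has a relatively open neighbourhood in $U$ which is cartesian. For $\beta\in\mathbb N_0^n$ and $V\subseteq\mathbb K^n$, let $V^{<\beta>}$ be the set of all $x=(x^{(1)},\dots,x^{(n)})$ with $x^{(i)}=(x^{(i)}_0,\dots,x^{(i)}_{\beta_i})\in\mathbb K^{1+\beta_i}$ such that $(x^{(1)}_{j_1},\dots,x^{(n)}_{j_n})\in V$ for all choices $0\le j_i\le\beta_i$, and let $V^{>\beta<}$ be the set of those $x\in V^{<\beta>}$ for which $x^{(i)}_0,\dots,x^{(i)}_{\beta_i}$ are pairwise distinct for each $i$. For $f\colon V\to E$ define $f^{>\beta<}\colon V^{>\beta<}\to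 E$ by $$f^{>\beta<}(x)=\sum_{j_1=0}^{\beta_1}\cdots\sum_{j_n=0}^{\beta_n}\Big(\prod_{i=1}^n\prod_{k\ne j_i}\frac1{x^{(i)}_{j_i}-x^{(i)}_k}\Big)f(x^{(1)}_{j_1},\dots,x^{(n)}_{j_n}).$$ Let $U\subseteq\mathbb K^n$ be locally cartesian and $\alpha\in(\mathbb N_0\cup\{\infty\})^n$. A map $f\colon U\to E$ is $C^\alpha$ if, for each relatively open cartesian subset $V\subseteq U$ and each $\beta\in\mathbb N_0^n$ with $\beta\le\alpha$, the map $(f|_V)^{>\beta<}$ has a (necessarily unique) continuous extension $(f|_V)^{<\beta>}\colon V^{<\beta>}\to E$. The space $C^\alpha(U,E)$ of all such maps carries the initial topology with respect to all maps $f\mapsto (f|_V)^{<\beta>}\in C(V^{<\beta>},E)$, where $C(V^{<\beta>},E)$ has the compact-open topology. If $n=n_1+\cdots+n_\ell$ with $\ell\ge 1$ and $n_1,\dots,n_\ell\ge 1$, so that $\mathbb K^n=\mathbb K^{n_1}\times\cdots\times\mathbb K^{n_\ell}$, and $\alpha\in(\mathbb N_0\cup\{\infty\})^\ell$, let $N_\alpha$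 be the set of all $\beta=(\beta_1,\dots,\beta_\ell)\in\mathbb N_0^{n_1}\times\cdots\times\mathbb N_0^{n_\ell}$ with $|\beta_j|\le\alpha_j$ for all $j$, where $|\cdot|$ denotes the sum of the entries. Then $C^\alpha(U,E):=\bigcap_{\beta\in N_\alpha}C^\beta(U,E)$, with the initial topology with respect to the inclusion maps into the spaces $C^\beta(U,E)$, $\beta\in N_\alpha$. For $r\in\mathbb N_0\cup\{\infty\}$, $C^r(U,E):=\bigcap_{\beta\in\mathbb N_0^n,\,|\beta|\le r}C^\beta(U,E)$, again with the initial topology with respect to the inclusion maps. Finally, $\mathrm{Pol}(U,E)$ is the space of all functions $U\to E$ of the form $x\mapsto\sum_{\beta\in\mathbb N_0^n}x^\beta a_\beta$ with $a_\beta\in E$, only finitely many of them non-zero. **Proposition.** Let $\ell\ge 1$, $n_1,\dots,n_\ell\ge 1$, and let $U\subseteq\mathbb K^{n_1}\times\cdots\times\mathbb K^{n_\ell}$ be locally closed and locally cartesian. Then $\mathrm{Pol}(U,E)$ is contained and dense in $C^\alpha(U,E)$, for every $\alpha\in(\mathbb N_0\cup\{\infty\})^\ell$. In particular (Theorem E),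 if $n\ge 1$ and $U\subseteq\mathbb K^n$ is locally closed and locally cartesian, then $\mathrm{Pol}(U,E)$ is contained and dense in $C^r(U,E)$ for every $r\in\mathbb N_0\cup\{\infty\}$, and in $C^\alpha(U,E)$ for every $\alpha\in(\mathbb N_0\cup\{\infty\})^n$. -/

import Mathlib

open Topology

noncomputable section

namespace CAlpha

/-! Throughout, `ι` is a finite index set and `ι → K` (with the product topology) is `K^n`, `n = #ι`.
Multi-indices are functions `ι → ℕ`, or `ι → ℕ∞` if the entry `∞` is allowed. -/

section Domains

variable {K : Type*} [TopologicalSpace K] {ι : Type*}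

/-- `U` is a product of subsets of `K` without isolated points. -/
def IsCartesian (U : Set (ι → K)) : Prop :=
  ∃ S : ι → Set K, (∀ i, Preperfect (S i)) ∧ U = Set.univ.pi S

/-- `V` is a subset of `U` which is relatively open in `U`. -/
def IsRelOpen (V U : Set (ι → K)) : Prop :=
  V ⊆ U ∧ IsOpen {x : U | (x : ι → K) ∈ V}

/-- Each point of `U` has a relatively open neighbourhood in `U` which is cartesian. -/
def IsLocallyCartesian (U : Set (ι → K)) : Prop :=
  ∀ x ∈ U, ∃ V, IsRelOpen V U ∧ x ∈ V ∧ IsCartesian V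

/-- The set `U^{<β>} ⊆ K^{n+|β|}` of all `x = (x⁽ⁱ⁾_k)`, where `0 ≤ k ≤ β i`, such that every
choice of one entry from each block `x⁽ⁱ⁾` gives a point of `U`. -/
def diffDomain (U : Set (ι → K)) (β : ι → ℕ) : Set ((i : ι) → Fin (β i + 1) → K) :=
  {x | ∀ j : (i : ι) → Fin (β i + 1), (fun i => x i (j i)) ∈ U}

/-- The set `U^{>β<}` of all points of `U^{<β>}` for which the entries of each block are
pairwise distinct. -/
def strictDiffDomain (U : Set (ι → K)) (β : ι → ℕ) : Set ((i : ι) → Fin (β i + 1) → K) :=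
  {x | x ∈ diffDomain U β ∧ ∀ i, Function.Injective (x i)}

end Domains

section Maps

variable {K : Type*} [Field K] [TopologicalSpace K] {ι : Type*} [Fintype ι] [DecidableEq ι]
variable {E : Type*} [AddCommGroup E] [Module K E] [TopologicalSpace E]

/-- The partial difference quotient map `f^{>β<} : U^{>β<} → E`. -/
def diffQuot {U : Set (ι → K)} (f : U → E) (β : ι → ℕ) (x : strictDiffDomain U β) : E :=
  ∑ j : (i : ι) → Fin (β i + 1),
    (∏ i, ∏ k ∈ Finset.univ.erase (j i), (1 / (x.1 i (j i) - x.1 i k))) •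
      f ⟨fun i => x.1 i (j i), x.2.1 j⟩

/-- The continuous map `g : U^{<β>} → E` extends `f^{>β<}`. -/
def ExtendsDiffQuot {U : Set (ι → K)} (f : U → E) (β : ι → ℕ) (g : C(diffDomain U β, E)) : Prop :=
  ∀ x : strictDiffDomain U β, g ⟨x.1, x.2.1⟩ = diffQuot f β x

/-- The restriction of `f : U → E` to a subset `V` of `U`. -/
def restr {U V : Set (ι → K)} (h : V ⊆ U) (f : U → E) : V → E := fun x => f (Set.inclusion h x)

/-- `f : U → E` is a `C^α`-map, for `α ∈ (ℕ ∪ {∞})^n`: for each relatively open cartesian `V ⊆ U`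
and each `β ≤ α` with finite entries, `(f|_V)^{>β<}` has a continuous extension to `V^{<β>}`. -/
def IsC (α : ι → ℕ∞) {U : Set (ι → K)} (f : U → E) : Prop :=
  ∀ (V : Set (ι → K)) (hV : IsRelOpen V U), IsCartesian V →
    ∀ β : ι → ℕ, (∀ i, (β i : ℕ∞) ≤ α i) →
      ∃ g : C(diffDomain V β, E), ExtendsDiffQuot (restr hV.1 f) β g

/-- The function space `C^α(U, E)`, for `α ∈ (ℕ ∪ {∞})^n`. -/
def CSpace (α : ι → ℕ∞) (U : Set (ι → K)) (E : Type*) [AddCommGroup E] [Module K E]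
    [TopologicalSpace E] : Type _ :=
  {f : U → E // IsC α f}

/-- The continuous extension `(f|_V)^{<β>}`; by `extendsDiffQuot_unique` below,
it is the only one if `E` is Hausdorff. -/
def extDiffQuot {α : ι → ℕ∞} {U : Set (ι → K)} (f : CSpace α U E)
    {V : Set (ι → K)} (hV : IsRelOpen V U) (hc : IsCartesian V)
    {β : ι → ℕ} (hβ : ∀ i, (β i : ℕ∞) ≤ α i) : C(diffDomain V β, E) :=
  (f.2 V hV hc β hβ).choose

/-- The compact-open `C^α`-topology: the initial topology with respect to all maps
`f ↦ (f|_V)^{<β>} ∈ C(V^{<β>}, E)`, the targets carrying the compact-open topology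
(Mathlib's topology on `C(X, Y)`). -/
instance CSpace.instTopologicalSpace (α : ι → ℕ∞) (U : Set (ι → K)) :
    TopologicalSpace (CSpace α U E) :=
  ⨅ (V : Set (ι → K)) (hV : IsRelOpen V U) (hc : IsCartesian V)
    (β : ι → ℕ) (hβ : ∀ i, (β i : ℕ∞) ≤ α i),
    TopologicalSpace.induced (fun f => extDiffQuot f hV hc hβ) inferInstance

/-- `f` is `C^β` for every multi-index `β` in the set `N`. -/
def IsCOn (N : Set (ι → ℕ)) {U : Set (ι → K)} (f : U → E) : Prop :=
  ∀ β ∈ N, IsC (fun i => (β i : ℕ∞)) f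

/-- The intersection of the spaces `C^β(U, E)` for `β ∈ N`. -/
def CSpaceOn (N : Set (ι → ℕ)) (U : Set (ι → K)) (E : Type*) [AddCommGroup E] [Module K E]
    [TopologicalSpace E] : Type _ :=
  {f : U → E // IsCOn N f}

/-- The inclusion map of the intersection into `C^β(U, E)`, for `β ∈ N`. -/
def CSpaceOn.incl {N : Set (ι → ℕ)} {U : Set (ι → K)} {β : ι → ℕ} (hβ : β ∈ N)
    (f : CSpaceOn N U E) : CSpace (fun i => (β i : ℕ∞)) U E :=
  ⟨f.1, f.2 β hβ⟩

/-- The initial topology with respect to the inclusion maps into `C^β(U, E)`, for `β ∈ N`. -/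
instance CSpaceOn.instTopologicalSpace (N : Set (ι → ℕ)) (U : Set (ι → K)) :
    TopologicalSpace (CSpaceOn N U E) :=
  ⨅ (β : ι → ℕ) (hβ : β ∈ N), TopologicalSpace.induced (CSpaceOn.incl hβ) inferInstance

/-- `p : U → E` is a polynomial function `p(x) = ∑_β x^β a_β` with finitely many non-zero
coefficients `a_β ∈ E`. -/
def IsPol {U : Set (ι → K)} (p : U → E) : Prop :=
  ∃ a : (ι → ℕ) →₀ E, ∀ x : U, p x = a.sum fun β c => (∏ i, x.1 i ^ β i) • c

end Maps

/-- The index set of the coordinates of `K^{n_1} × ⋯ × K^{n_ℓ}`. -/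
abbrev BlockIndex {ℓ : ℕ} (n : Fin ℓ → ℕ) : Type := (j : Fin ℓ) × Fin (n j)

/-- The set `N_α` of all `β = (β_1, …, β_ℓ) ∈ ℕ^{n_1} × ⋯ × ℕ^{n_ℓ}` with `|β_j| ≤ α_j` for all
`j`; thus `IsCOn (blockIndices n α)` and `CSpaceOn (blockIndices n α)` describe `C^α`-maps on
subsets of `K^{n_1} × ⋯ × K^{n_ℓ}`, for `α ∈ (ℕ ∪ {∞})^ℓ`. -/
def blockIndices {ℓ : ℕ} (n : Fin ℓ → ℕ) (α : Fin ℓ → ℕ∞) : Set (BlockIndex n → ℕ) :=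
  {β | ∀ j, ((∑ k, β ⟨j, k⟩ : ℕ) : ℕ∞) ≤ α j}

/-- The set of all `β ∈ ℕ^n` with `|β| ≤ r`; thus `IsCOn (totalIndices n r)` and
`CSpaceOn (totalIndices n r)` describe `C^r`-maps on subsets of `K^n`. -/
def totalIndices (n : ℕ) (r : ℕ∞) : Set (Fin n → ℕ) :=
  {β | ((∑ i, β i : ℕ) : ℕ∞) ≤ r}

/-- Local convexity of a topological vector space `E` over an ultrametric field `K`: the open
submodules over the valuation ring `{c | ‖c‖ ≤ 1}` form a basis of `0`-neighbourhoods. -/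
def IsLocallyConvex (K : Type*) [NormedField K] (E : Type*) [AddCommGroup E] [Module K E]
    [TopologicalSpace E] : Prop :=
  ∀ W ∈ 𝓝 (0 : E), ∃ M : AddSubgroup E, IsOpen (M : Set E) ∧
    (∀ c : K, ‖c‖ ≤ 1 → ∀ x ∈ M, c • x ∈ M) ∧ (M : Set E) ⊆ W

section Uniqueness

variable {K : Type*} [TopologicalSpace K] [T1Space K] {ι : Type*} [DecidableEq ι]

/-- `V^{>β<}` is dense in `V^{<β>}` if `V` is cartesian. -/
theorem diffDomain_subset_closure {V : Set (ι → K)} (hc : IsCartesian V) (β : ι → ℕ) :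
    diffDomain V β ⊆ closure (strictDiffDomain V β) := by
  classical
  obtain ⟨S, hS, rfl⟩ := hc
  intro x hx
  have hxS : ∀ i k, x i k ∈ S i := fun i k => by
    have := hx (Function.update (fun _ => 0) i k) i (Set.mem_univ i)
    simpa using this
  rw [mem_closure_iff_nhds]
  intro t ht
  rw [nhds_pi, Filter.mem_pi'] at ht
  obtain ⟨I, u, hu, hut⟩ := ht
  have key : ∀ i, ∃ y : Fin (β i + 1) → K,
      y ∈ u i ∧ (∀ k, y k ∈ S i) ∧ Function.Injective y := by
    intro i
    have hi := hu i
    rw [nhds_pi, Filter.mem_pi'] at hi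
    obtain ⟨J, w, hw, hwu⟩ := hi
    have hinf : ∀ k, (w k ∩ S i).Infinite := fun k => by
      have hacc := (hS i _ (hxS i k)).nhds_inter (hw k)
      exact Set.Infinite.of_accPt hacc
    choose F hF hFc using fun k => (hinf k).exists_subset_card_eq (β i + 1)
    obtain ⟨y, hy, hyF⟩ := (Finset.all_card_le_biUnion_card_iff_exists_injective F).1 (by
      intro s
      rcases s.eq_empty_or_nonempty with rfl | ⟨k, hk⟩
      · simp
      · calc s.card ≤ Fintype.card (Fin (β i + 1)) := s.card_le_univ
          _ = (F k).card := by rw [hFc, Fintype.card_fin]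
          _ ≤ _ := Finset.card_le_card (Finset.subset_biUnion_of_mem F hk))
    have hyw : ∀ k, y k ∈ w k ∩ S i := fun k => hF k (hyF k)
    exact ⟨y, hwu fun k _ => (hyw k).1, fun k => (hyw k).2, hy⟩
  choose y hyu hyS hyi using key
  exact ⟨y, hut fun i _ => hyu i, fun j i _ => hyS i (j i), hyi⟩

end Uniqueness

/-- Continuous extensions of `f^{>β<}` are unique if the domain of `f` is cartesian. -/
theorem extendsDiffQuot_unique {K : Type*} [Field K] [TopologicalSpace K] [T1Space K]
    {ι : Type*} [Fintype ι] [DecidableEq ι] {E : Type*} [AddCommGroup E] [Module K E]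
    [TopologicalSpace E] [T2Space E] {V : Set (ι → K)} (hc : IsCartesian V) {f : V → E}
    {β : ι → ℕ} {g h : C(diffDomain V β, E)} (hg : ExtendsDiffQuot f β g)
    (hh : ExtendsDiffQuot f β h) : g = h := by
  have hd : Dense {x : diffDomain V β | (x : (i : ι) → Fin (β i + 1) → K) ∈
      strictDiffDomain V β} := by
    intro x
    have := diffDomain_subset_closure hc β x.2
    rw [closure_subtype]
    refine closure_mono ?_ this
    intro z hz
    exact ⟨⟨z, hz.1⟩, hz, rfl⟩
  refine DFunLike.coe_injective (Continuous.ext_on hd g.continuous h.continuous ?_)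
  intro x hx
  exact (hg ⟨x.1, hx⟩).trans (hh ⟨x.1, hx⟩).symm

end CAlpha

end

open CAlpha

noncomputable section

set_option linter.unusedSectionVars false

namespace CAlpha

/-! Every condition concerns the divided differences `f[X₁ × ⋯ × Xₙ]` on finite grids. These are
tensor products of the one-variable functionals `dd`, so one-variable identities act in each
coordinate separately. In `E`, an open subgroup `M` stable under scalars of norm at most 1 plays the
role of a ball. Such an `M` is also closed, and pairwise distinct entries are dense in `V^{<β>}`.
Density of the polynomials therefore reduces to this: for a compact `L ⊆ U` and finite block orders,
find a polynomial `p` such that all divided differences of `f - p` of these orders, on grids in `U`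
near `L`, lie in `M` (`exists_polynomialFun_approx`).

The recursion `(u - v) f[X] = f[X \ v] - f[X \ u]` is used in two opposite ways. If `‖u - v‖` is
large, it bounds a divided difference by ones of lower order; hence estimates on grids of small
diameter, weighted by powers of `ρ⁻¹`, give estimates on all grids (`gdq_mem_of_local`). If `‖u -
v‖` is small, it allows a point to be exchanged for a node at a small cost (`interp_local`).

On a cartesian piece, `f` is approximated by Newton interpolation whose nodes depend only on the
ball of radius `‖ρ‖` containing the point. The result is a polynomial on each polydisc of that
radius. At top order the error is a variation of divided differences of `f`, small by uniform
continuity near compact sets; lower orders follow by exchanging points for nodes, and blocks of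
variables are treated successively (`interp_error`, `foldr_interp_error`). Finitely many cartesian
pieces cover `L` and are glued along ultrametric balls.

Finally, a locally polynomial function is replaced by a polynomial near `L`. Its restriction to one
polydisc, extended by zero, is a sum of products of one-variable functions. It thus suffices to have
polynomials close to 1 on one ball and close to 0 on finitely many others, together with all divided
differences (`exists_polynomial_ball`). Estimates multiply because the scaled norm in `HasDqBound`
is submultiplicative. -/

open Classical in
/-- The functional `F ↦ F[X]` (divided difference of `F` at the points of `X`), as a formal linear
combination of points. -/
def dd {K : Type*} [Field K] (X : Finset K) : K →₀ K :=
  ∑ u ∈ X, Finsupp.single u (∏ y ∈ X.erase u, (u - y)⁻¹)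

/-! ### Divided differences in one variable and Newton polynomials. -/

section OneVariable

variable {K : Type*} [Field K] {E : Type*} [AddCommGroup E] [Module K E]

open Classical in
theorem dd_apply (X : Finset K) (t : K) :
    dd X t = if t ∈ X then ∏ y ∈ X.erase t, (t - y)⁻¹ else 0 := by
  simp [dd, Finsupp.finsetSum_apply, Finsupp.single_apply]

@[simp]
theorem dd_empty : dd (∅ : Finset K) = 0 := by simp [dd]

@[simp]
theorem dd_singleton (t : K) : dd {t} = Finsupp.single t 1 := by simp [dd]

open Classical in
-- Partial fractions at each point: `1/(t - u) - 1/(t - v) = (u - v)/((t - u)(t - v))`. This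
-- recursion carries all the estimates below.
theorem dd_erase_sub_erase {X : Finset K} {u v : K} (hu : u ∈ X) (hv : v ∈ X) (h : u ≠ v) :
    (u - v) • dd X = dd (X.erase v) - dd (X.erase u) := by
  ext t
  have huv : u - v ≠ 0 := sub_ne_zero.2 h
  simp only [Finsupp.smul_apply, Finsupp.sub_apply, dd_apply, Finset.mem_erase, smul_eq_mul]
  by_cases ht : t ∈ X
  · rcases eq_or_ne t u with rfl | htu
    · have e : v ∈ X.erase t := by simp [h.symm, hv]
      have := Finset.mul_prod_erase _ (fun y => (t - y)⁻¹) e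
      simp only [ht, if_true, h, ne_eq, not_true_eq_false, false_and, if_false, sub_zero,
        not_false_eq_true, true_and]
      rw [← this, ← mul_assoc, mul_inv_cancel₀ huv, one_mul, Finset.erase_right_comm]
    · rcases eq_or_ne t v with rfl | htv
      · have e : u ∈ X.erase t := by simp [h, hu]
        have := Finset.mul_prod_erase _ (fun y => (t - y)⁻¹) e
        simp only [ht, if_true, ne_eq, not_true_eq_false, false_and, if_false, zero_sub,
          not_false_eq_true, true_and, htu]
        rw [← this, ← mul_assoc, ← neg_sub t u, neg_mul, mul_inv_cancel₀ (sub_ne_zero.2 htu),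
          neg_one_mul, Finset.erase_right_comm]
      · have e : u ∈ X.erase t := by simp [htu.symm, hu]
        have e' : v ∈ X.erase t := by simp [htv.symm, hv]
        have e2 : v ∈ (X.erase t).erase u := by simp [htv.symm, hv, h.symm]
        have e3 : u ∈ (X.erase t).erase v := by simp [htu.symm, hu, h]
        have a1 := Finset.mul_prod_erase _ (fun y => (t - y)⁻¹) e
        have a2 := Finset.mul_prod_erase _ (fun y => (t - y)⁻¹) e2
        have a3 := Finset.mul_prod_erase _ (fun y => (t - y)⁻¹) e3
        simp only [ht, if_true, ne_eq, htu, htv, not_false_eq_true, true_and]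
        rw [← a1, Finset.erase_right_comm (a := v), Finset.erase_right_comm (a := u), ← a2, ← a3,
          Finset.erase_right_comm (a := v) (b := u)]
        have h1 := sub_ne_zero.2 htu
        have h2 := sub_ne_zero.2 htv
        field_simp
        ring
  · simp [ht]

/-- Multiplication of a formal combination of points by a function. -/
def mulPt (F : K → K) : (K →₀ K) →ₗ[K] (K →₀ K) :=
  Finsupp.linearCombination K fun t => Finsupp.single t (F t)

theorem mulPt_apply (F : K → K) (μ : K →₀ K) (t : K) : mulPt F μ t = F t * μ t := by
  classical
  rw [mulPt, Finsupp.linearCombination_apply, Finsupp.sum_apply, Finsupp.sum]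
  simp only [Finsupp.smul_apply, Finsupp.single_apply, smul_eq_mul, mul_ite, mul_zero]
  rw [Finset.sum_ite_eq']
  split_ifs with h
  · ring
  · simp [Finsupp.notMem_support_iff.1 h]

open Classical in
-- The factor `t - u` cancels one denominator in the weight of each `t ≠ u` and annihilates the
-- weight of `u`.
theorem mulPt_dd {X : Finset K} {u : K} (hu : u ∈ X) :
    mulPt (fun t => t - u) (dd X) = dd (X.erase u) := by
  ext t
  simp only [mulPt_apply, dd_apply, Finset.mem_erase]
  rcases eq_or_ne t u with rfl | htu
  · simp
  · by_cases ht : t ∈ X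
    · have e : u ∈ X.erase t := by simp [htu.symm, hu]
      have := Finset.mul_prod_erase _ (fun y => (t - y)⁻¹) e
      simp only [ht, htu, ne_eq, not_false_eq_true, true_and, if_true]
      rw [← this, ← mul_assoc, mul_inv_cancel₀ (sub_ne_zero.2 htu), one_mul,
        Finset.erase_right_comm]
    · simp [ht]

/-- The divided difference `F[X]`. -/
def dq (F : K → E) (X : Finset K) : E := Finsupp.linearCombination K F (dd X)

theorem dq_eq_sum (F : K → E) (X : Finset K) : dq F X = ∑ u ∈ X, dd X u • F u := by
  classical
  rw [dq, dd, map_sum]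
  refine Finset.sum_congr rfl fun u hu => ?_
  rw [Finsupp.linearCombination_single, ← dd, dd_apply, if_pos hu]

@[simp]
theorem dq_empty (F : K → E) : dq F ∅ = 0 := by simp [dq]

@[simp]
theorem dq_singleton (F : K → E) (t : K) : dq F {t} = F t := by simp [dq]

theorem dq_add (F G : K → E) (X : Finset K) : dq (fun t => F t + G t) X = dq F X + dq G X := by
  simp [dq_eq_sum, Finset.sum_add_distrib]

theorem dq_sub (F G : K → E) (X : Finset K) : dq (fun t => F t - G t) X = dq F X - dq G X := by
  simp [dq_eq_sum, Finset.sum_sub_distrib, smul_sub]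

theorem dq_const_mul (c : K) (F : K → K) (X : Finset K) :
    dq (fun t => c * F t) X = c * dq F X := by
  simp only [dq_eq_sum, Finset.mul_sum, smul_eq_mul]
  exact Finset.sum_congr rfl fun _ _ => by ring

theorem dq_congr {F G : K → E} {X : Finset K} (h : ∀ t ∈ X, F t = G t) : dq F X = dq G X := by
  rw [dq_eq_sum, dq_eq_sum]
  exact Finset.sum_congr rfl fun t ht => by rw [h t ht]

open Classical in
theorem dq_erase_sub_erase (F : K → E) {X : Finset K} {u v : K} (hu : u ∈ X) (hv : v ∈ X)
    (h : u ≠ v) : (u - v) • dq F X = dq F (X.erase v) - dq F (X.erase u) := by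
  simp only [dq, ← map_smul, ← map_sub, dd_erase_sub_erase hu hv h]

open Classical in
theorem dq_sub_mul (F : K → K) {X : Finset K} {u : K} (hu : u ∈ X) :
    dq (fun t => (t - u) * F t) X = dq F (X.erase u) := by
  rw [dq, dq, ← mulPt_dd hu]
  have : Finsupp.linearCombination K (fun t => (t - u) * F t) =
      Finsupp.linearCombination K F ∘ₗ mulPt (fun t => t - u) := by
    ext t
    simp [mulPt]
    ring
  rw [this]
  rfl

open Classical in
/-- Leibniz' rule for a linear factor. -/
theorem dq_linear_mul (F : K → K) (a : K) {X : Finset K} {u : K} (hu : u ∈ X) :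
    dq (fun t => (t - a) * F t) X = dq F (X.erase u) + (u - a) * dq F X := by
  rw [← dq_sub_mul F hu, ← dq_const_mul, ← dq_add]
  congr 1
  ext t
  ring

theorem dq_const (c : K) {X : Finset K} (hX : 2 ≤ X.card) : dq (fun _ => c) X = 0 := by
  classical
  induction' h : X.card using Nat.strong_induction_on with n ih generalizing X
  obtain ⟨u, hu, v, hv, huv⟩ := Finset.one_lt_card.1 hX
  have key := dq_erase_sub_erase (fun _ => c) hu hv huv
  have cu := Finset.card_erase_of_mem hu
  have cv := Finset.card_erase_of_mem hv
  have : dq (fun _ => c) (X.erase v) - dq (fun _ => c) (X.erase u) = 0 := by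
    rcases Nat.lt_or_ge X.card 3 with h3 | h3
    · obtain ⟨a, ha⟩ := Finset.card_eq_one.1 (show (X.erase u).card = 1 by omega)
      obtain ⟨b, hb⟩ := Finset.card_eq_one.1 (show (X.erase v).card = 1 by omega)
      simp [ha, hb]
    · rw [ih _ (by omega) (by omega) rfl, ih _ (by omega) (by omega) rfl, sub_zero]
  rw [this] at key
  exact (smul_eq_zero.1 key).resolve_left (sub_ne_zero.2 huv)

/-- The Newton polynomials `∏_{k < m} (t - a k)`. -/
def newton (a : ℕ → K) (m : ℕ) (t : K) : K := ∏ k ∈ Finset.range m, (t - a k)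

theorem newton_succ (a : ℕ → K) (m : ℕ) :
    newton a (m + 1) = fun t => (t - a m) * newton a m t := by
  ext t
  rw [newton, Finset.prod_range_succ, mul_comm, newton]

/-- Divided differences of order above the degree vanish, by induction with Leibniz' rule for a
linear factor. The points of `X` need not be related to the nodes `a`. -/
theorem dq_newton_of_lt (a : ℕ → K) {m : ℕ} {X : Finset K} (h : m + 1 < X.card) :
    dq (newton a m) X = 0 := by
  classical
  induction m generalizing X with
  | zero =>
    have : newton a 0 = fun _ => 1 := by ext; simp [newton]
    rw [this, dq_const _ (by omega)]
  | succ m ih =>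
    obtain ⟨u, hu⟩ := Finset.card_pos.1 (show 0 < X.card by omega)
    have := Finset.card_erase_of_mem hu
    rw [newton_succ, dq_linear_mul _ _ hu, ih (by omega), ih (by omega)]
    simp

/-- At order equal to the degree, the divided difference is the leading coefficient. -/
theorem dq_newton_of_eq (a : ℕ → K) {m : ℕ} {X : Finset K} (h : X.card = m + 1) :
    dq (newton a m) X = 1 := by
  classical
  induction m generalizing X with
  | zero =>
    obtain ⟨u, rfl⟩ := Finset.card_eq_one.1 h
    simp [newton]
  | succ m ih =>
    obtain ⟨u, hu⟩ := Finset.card_pos.1 (show 0 < X.card by omega)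
    have := Finset.card_erase_of_mem hu
    rw [newton_succ, dq_linear_mul _ _ hu, ih (by omega), dq_newton_of_lt _ (by omega)]
    simp

theorem dq_newton_nodes (a : ℕ → K) {m n : ℕ} {X : Finset K} (h : n < m)
    (hX : ∀ t ∈ X, ∃ k ≤ n, t = a k) : dq (newton a m) X = 0 := by
  rw [dq_congr (G := fun _ => (0 : K)), dq_eq_sum]
  · simp
  · intro t ht
    obtain ⟨k, hk, rfl⟩ := hX t ht
    exact Finset.prod_eq_zero (Finset.mem_range.2 (hk.trans_lt h)) (sub_self _)

end OneVariable

/-! ### Divided differences on grids as tensor products. -/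

section SeveralVariables

variable {K : Type*} [Field K] {ι : Type*} [Fintype ι] [DecidableEq ι]
variable {E : Type*} [AddCommGroup E] [Module K E]

open Classical in
/-- The functional `f ↦ (μ_1 ⊗ ⋯ ⊗ μ_n)(f)` on functions of several variables, as a multilinear map
in the formal combinations `μ_i` of points. -/
def tensorEval (f : (ι → K) → E) : MultilinearMap K (fun _ : ι => K →₀ K) E :=
  (Finsupp.linearCombination K f ∘ₗ
    (PiTensorProduct.ofFinsuppEquiv' (R := K) (κ := fun _ : ι => K)).toLinearMap).compMultilinearMap
      (PiTensorProduct.tprod K)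

theorem tensorEval_single (f : (ι → K) → E) (x c : ι → K) :
    tensorEval f (fun i => Finsupp.single (x i) (c i)) = (∏ i, c i) • f x := by
  classical
  simp only [tensorEval, LinearMap.compMultilinearMap_apply, LinearMap.comp_apply,
    LinearEquiv.coe_coe]
  rw [PiTensorProduct.ofFinsuppEquiv'_tprod_single, Finsupp.linearCombination_single]

theorem tensorEval_point (f : (ι → K) → E) (x : ι → K) :
    tensorEval f (fun i => Finsupp.single (x i) 1) = f x := by
  rw [tensorEval_single]
  simp

/-- Point masses form a basis, so an identity of multilinear functionals need only be checked on
points. -/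
theorem tensorEval_ext {F G : MultilinearMap K (fun _ : ι => K →₀ K) E}
    (h : ∀ x : ι → K, F (fun i => Finsupp.single (x i) 1) = G (fun i => Finsupp.single (x i) 1)) :
    F = G := by
  refine Module.Basis.ext_multilinear (fun _ => Finsupp.basisSingleOne) fun v => ?_
  simpa using h v

theorem tensorEval_eq_of_point (f : (ι → K) → E)
    (F : MultilinearMap K (fun _ : ι => K →₀ K) E)
    (h : ∀ x : ι → K, F (fun i => Finsupp.single (x i) 1) = f x) : tensorEval f = F :=
  tensorEval_ext fun x => by rw [tensorEval_point, h]

theorem tensorEval_add (f g : (ι → K) → E) : tensorEval (f + g) = tensorEval f + tensorEval g :=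
  tensorEval_eq_of_point _ _ fun x => by simp [tensorEval_point]

theorem tensorEval_sub (f g : (ι → K) → E) : tensorEval (f - g) = tensorEval f - tensorEval g :=
  tensorEval_eq_of_point _ _ fun x => by simp [tensorEval_point]

theorem tensorEval_sum {σ : Type*} (s : Finset σ) (f : σ → (ι → K) → E) :
    tensorEval (∑ k ∈ s, f k) = ∑ k ∈ s, tensorEval (f k) :=
  tensorEval_eq_of_point _ _ fun x => by
    simp [tensorEval_point]

/-- The divided difference of `f` on the grid `∏ X i`. -/
def gdq (f : (ι → K) → E) (X : ι → Finset K) : E := tensorEval f fun i => dd (X i)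

theorem gdq_eq_sum (f : (ι → K) → E) (X : ι → Finset K) :
    gdq f X = ∑ x ∈ Fintype.piFinset X, (∏ i, dd (X i) (x i)) • f x := by
  classical
  have : (fun i => dd (X i)) = fun i => ∑ u ∈ X i, Finsupp.single u (dd (X i) u) := by
    ext1 i
    conv_lhs => rw [dd]
    exact Finset.sum_congr rfl fun u hu => by rw [dd_apply, if_pos hu]
  rw [gdq, this, MultilinearMap.map_sum_finset]
  exact Finset.sum_congr rfl fun x _ => tensorEval_single _ _ _

theorem gdq_congr {f g : (ι → K) → E} {X : ι → Finset K}
    (h : ∀ x, (∀ i, x i ∈ X i) → f x = g x) : gdq f X = gdq g X := by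
  rw [gdq_eq_sum, gdq_eq_sum]
  exact Finset.sum_congr rfl fun x hx => by rw [h x (Fintype.mem_piFinset.1 hx)]

theorem gdq_add (f g : (ι → K) → E) (X : ι → Finset K) : gdq (f + g) X = gdq f X + gdq g X := by
  simp [gdq, tensorEval_add]

theorem gdq_sub (f g : (ι → K) → E) (X : ι → Finset K) : gdq (f - g) X = gdq f X - gdq g X := by
  simp [gdq, tensorEval_sub]

theorem gdq_zero (X : ι → Finset K) : gdq (0 : (ι → K) → E) X = 0 := by
  simp [gdq_eq_sum]

theorem gdq_neg (f : (ι → K) → E) (X : ι → Finset K) : gdq (-f) X = -gdq f X := by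
  rw [← zero_sub, gdq_sub, gdq_zero, zero_sub]

theorem gdq_sum {σ : Type*} (s : Finset σ) (f : σ → (ι → K) → E) (X : ι → Finset K) :
    gdq (∑ k ∈ s, f k) X = ∑ k ∈ s, gdq (f k) X := by
  simp [gdq, tensorEval_sum]

/-- Expand the product of sums. This reduces estimates for monomials, and for products of functions
supported on balls, to one variable. -/
theorem gdq_prod_smul (F : ι → K → K) (e : E) (X : ι → Finset K) :
    gdq (fun x => (∏ i, F i (x i)) • e) X = (∏ i, dq (F i) (X i)) • e := by
  simp only [gdq_eq_sum, dq_eq_sum, Finset.prod_univ_sum, Finset.sum_smul, smul_smul,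
    Finset.prod_mul_distrib, smul_eq_mul]

/-- The one-variable recursion, inserted in the slot `i` of a multilinear map. -/
theorem gdq_erase_sub_erase (f : (ι → K) → E) {X : ι → Finset K} {i : ι} {u v : K}
    [DecidableEq K] (hu : u ∈ X i) (hv : v ∈ X i) (h : u ≠ v) :
    (u - v) • gdq f X = gdq f (Function.update X i ((X i).erase v)) -
      gdq f (Function.update X i ((X i).erase u)) := by
  have e : ∀ Z : Finset K, (fun k => dd (Function.update X i Z k)) =
      Function.update (fun k => dd (X k)) i (dd Z) := fun Z => by
    ext1 k
    rcases eq_or_ne k i with rfl | hk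
    · simp
    · simp [hk]
  have key := dd_erase_sub_erase hu hv h
  have := congrArg (fun ν => tensorEval f (Function.update (fun k => dd (X k)) i ν)) key
  simp only [MultilinearMap.map_update_smul, MultilinearMap.map_update_sub] at this
  rw [gdq, gdq, gdq, e, e]
  convert this using 2 <;> first | (congr!; done) | skip
  rw [Function.update_eq_self]

end SeveralVariables

/-! ### Difference quotients as divided differences on grids. -/

section DiffQuot

variable {K : Type*} [Field K] [TopologicalSpace K] {ι : Type*} [Fintype ι] [DecidableEq ι]
variable {E : Type*} [AddCommGroup E] [Module K E] [TopologicalSpace E]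

open Classical in
/-- The extension by zero of a function on `U`. -/
def extZero {U : Set (ι → K)} (f : U → E) (x : ι → K) : E := if h : x ∈ U then f ⟨x, h⟩ else 0

theorem extZero_of_mem {U : Set (ι → K)} (f : U → E) {x : ι → K} (h : x ∈ U) :
    extZero f x = f ⟨x, h⟩ := dif_pos h

open Classical in
theorem dd_image {n : ℕ} {x : Fin n → K} (hx : Function.Injective x) :
    dd (Finset.univ.image x) =
      ∑ j, Finsupp.single (x j) (∏ k ∈ Finset.univ.erase j, (1 / (x j - x k))) := by
  rw [dd, Finset.sum_image hx.injOn]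
  refine Finset.sum_congr rfl fun j _ => ?_
  congr 1
  rw [← Finset.image_erase hx, Finset.prod_image hx.injOn]
  simp

open Classical in
-- Only the set of entries of each block matters, not their enumeration. Extending by zero is
-- harmless since every grid point lies in `V ⊆ U`.
theorem diffQuot_restr {U V : Set (ι → K)} (h : V ⊆ U) (f : U → E) (β : ι → ℕ)
    (x : strictDiffDomain V β) :
    diffQuot (restr h f) β x = gdq (extZero f) fun i => Finset.univ.image (x.1 i) := by
  simp only [gdq, dd_image (x.2.2 _), MultilinearMap.map_sum, diffQuot]
  refine Finset.sum_congr rfl fun j _ => ?_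
  rw [tensorEval_single, extZero_of_mem f (h (x.2.1 j))]
  rfl

end DiffQuot

/-! ### From grids of small diameter to all grids. -/

section Splitting

variable {K : Type*} [NormedField K] {ι : Type*} [Fintype ι] [DecidableEq ι]
variable {E : Type*} [AddCommGroup E] [Module K E]

/-- The order of the divided difference on a grid. -/
def gridOrder (X : ι → Finset K) (i : ι) : ℕ := (X i).card - 1

theorem gridOrder_add_one {X : ι → Finset K} {i : ι} (h : (X i).Nonempty) :
    gridOrder X i + 1 = (X i).card := Nat.sub_add_cancel h.card_pos

theorem gridOrder_mono {X Y : ι → Finset K} (h : ∀ i, Y i ⊆ X i) : gridOrder Y ≤ gridOrder X :=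
  fun i => Nat.sub_le_sub_right (Finset.card_le_card (h i)) 1

theorem smul_pow_inv_mem {M : AddSubgroup E} (hM : ∀ c : K, ‖c‖ ≤ 1 → ∀ x ∈ M, c • x ∈ M)
    {ρ : K} (hρ : ρ ≠ 0) (hρ1 : ‖ρ‖ ≤ 1) {k : ℕ} {e : E} (h : (ρ⁻¹) ^ k • e ∈ M) : e ∈ M := by
  have := hM (ρ ^ k) (by rw [norm_pow]; exact pow_le_one₀ (norm_nonneg _) hρ1) _ h
  rwa [smul_smul, inv_pow, mul_inv_cancel₀ (pow_ne_zero _ hρ), one_smul] at this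

/-- A bound on the divided differences on all grids which are small in the directions of `B`
implies a bound on all grids. -/
theorem gdq_mem_of_local {M : AddSubgroup E} (hM : ∀ c : K, ‖c‖ ≤ 1 → ∀ x ∈ M, c • x ∈ M)
    {ρ : K} (hρ : ρ ≠ 0) {B : Finset ι} {r : ℕ} {R : (ι → K) → E} {Q : (ι → Finset K) → Prop}
    (hne : ∀ X, Q X → ∀ i, (X i).Nonempty)
    (hmono : ∀ X Y, Q X → (∀ i, Y i ⊆ X i) → (∀ i, (Y i).Nonempty) → Q Y)
    (hr : ∀ X, Q X → ∑ i ∈ B, gridOrder X i ≤ r)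
    (hloc : ∀ X, Q X → (∀ i ∈ B, ∀ u ∈ X i, ∀ v ∈ X i, ‖u - v‖ ≤ ‖ρ‖) →
      (ρ⁻¹) ^ (r - ∑ i ∈ B, gridOrder X i) • gdq R X ∈ M)
    (X : ι → Finset K) (hX : Q X) : (ρ⁻¹) ^ (r - ∑ i ∈ B, gridOrder X i) • gdq R X ∈ M := by
  classical
  induction' h : ∑ i ∈ B, gridOrder X i using Nat.strong_induction_on with n ih generalizing X
  by_cases hl : ∀ i ∈ B, ∀ u ∈ X i, ∀ v ∈ X i, ‖u - v‖ ≤ ‖ρ‖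
  · rw [← h]; exact hloc X hX hl
  push Not at hl
  obtain ⟨i, hi, u, hu, v, hv, huv⟩ := hl
  have huv0 : u - v ≠ 0 := by
    intro h0
    rw [h0, norm_zero] at huv
    exact absurd huv (not_lt.2 (norm_nonneg _))
  -- The points `u`, `v` are more than `‖ρ‖` apart. Removing either one lowers the order by one, so
  -- the inductive bound has one more factor `ρ⁻¹`, which pays for the division by `u - v`.
  have key := gdq_erase_sub_erase R hu hv (sub_ne_zero.1 huv0)
  have step : ∀ w ∈ X i, ∀ w' ∈ X i, w' ≠ w →
      (ρ⁻¹) ^ (r - (n - 1)) • gdq R (Function.update X i ((X i).erase w)) ∈ M ∧ 1 ≤ n := by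
    intro w hw w' hw' hww
    have hsub : ∀ k, Function.update X i ((X i).erase w) k ⊆ X k := by
      intro k
      rcases eq_or_ne k i with rfl | hk
      · simp [Finset.erase_subset]
      · simp [hk]
    have hn : ∀ k, (Function.update X i ((X i).erase w) k).Nonempty := by
      intro k
      rcases eq_or_ne k i with rfl | hk
      · simpa using ⟨w', by simp [hww, hw']⟩
      · simpa [hk] using hne X hX k
    have hc := Finset.card_erase_of_mem hw
    have hpos : 0 < ((X i).erase w).card := by
      have := hn i
      rw [Function.update_self] at this
      exact this.card_pos
    have hs : ∑ k ∈ B, gridOrder (Function.update X i ((X i).erase w)) k + 1 = n := by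
      rw [← h, ← Finset.add_sum_erase _ _ hi, ← Finset.add_sum_erase _ _ hi]
      have e1 : ∑ k ∈ B.erase i, gridOrder (Function.update X i ((X i).erase w)) k =
          ∑ k ∈ B.erase i, gridOrder X k :=
        Finset.sum_congr rfl fun k hk => by simp [gridOrder, (Finset.mem_erase.1 hk).1]
      rw [e1]
      simp only [gridOrder, Function.update_self]
      omega
    have := ih (n - 1) (by omega) _ (hmono X _ hX hsub hn) (by omega)
    exact ⟨this, by omega⟩
  obtain ⟨mu, hn1⟩ := step u hu v hv (sub_ne_zero.1 huv0).symm
  obtain ⟨mv, -⟩ := step v hv u hu (sub_ne_zero.1 huv0)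
  have hnr := hr X hX
  have e : gdq R X = (u - v)⁻¹ • (gdq R (Function.update X i ((X i).erase v)) -
      gdq R (Function.update X i ((X i).erase u))) := by
    rw [← key, smul_smul, inv_mul_cancel₀ huv0, one_smul]
  have hk : r - (n - 1) = (r - n) + 1 := by omega
  have e2 : (ρ⁻¹) ^ (r - n) • gdq R X = (ρ * (u - v)⁻¹) •
      ((ρ⁻¹) ^ (r - (n - 1)) • gdq R (Function.update X i ((X i).erase v)) -
       (ρ⁻¹) ^ (r - (n - 1)) • gdq R (Function.update X i ((X i).erase u))) := by
    rw [e, ← smul_sub, smul_smul, smul_smul, hk]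
    congr 1
    rw [pow_succ]
    field_simp
  rw [e2]
  refine hM _ ?_ _ (M.sub_mem mv mu)
  rw [norm_mul, norm_inv, ← div_eq_mul_inv]
  exact div_le_one_of_le₀ huv.le (norm_nonneg _)

end Splitting

/-! ### Newton interpolation with locally constant nodes, and its error. -/

section Interpolation

variable {K : Type*} [NormedField K] {ι : Type*} [Fintype ι] [DecidableEq ι]
variable {E : Type*} [AddCommGroup E] [Module K E]

open Classical in
/-- The first `m + 1` nodes. -/
def nodeSet (a : ℕ → K) (m : ℕ) : Finset K := (Finset.range (m + 1)).image a

theorem card_nodeSet {a : ℕ → K} (ha : Function.Injective a) (m : ℕ) :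
    (nodeSet a m).card = m + 1 := by
  classical
  rw [nodeSet, Finset.card_image_of_injective _ ha, Finset.card_range]

/-- The functional `F ↦ F[a_0, …, a_m] ∏_{k < m} (t - a_k)`, extended linearly in `t`, where
the nodes `a_k` may depend on `t`. -/
def newtonPt (a : K → ℕ → K) (m : ℕ) : (K →₀ K) →ₗ[K] (K →₀ K) :=
  Finsupp.linearCombination K fun t => newton (a t) m t • dd (nodeSet (a t) m)

theorem newtonPt_single (a : K → ℕ → K) (m : ℕ) (t : K) :
    newtonPt a m (Finsupp.single t 1) = newton (a t) m t • dd (nodeSet (a t) m) := by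
  simp [newtonPt]

/-- With the nodes constant on `X`, the functional splits: the dependence on `t` is the Newton
polynomial, and the divided difference at the nodes is a fixed factor. -/
theorem newtonPt_dd {a : K → ℕ → K} {b : ℕ → K} (m : ℕ) {X : Finset K} (h : ∀ u ∈ X, a u = b) :
    newtonPt a m (dd X) = dq (newton b m) X • dd (nodeSet b m) := by
  classical
  rw [dd, map_sum, dq_eq_sum, Finset.sum_smul]
  refine Finset.sum_congr rfl fun u hu => ?_
  rw [newtonPt, Finsupp.linearCombination_single, h u hu, dd_apply, if_pos hu, smul_smul,
    smul_eq_mul]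

/-- The multi-indices supported in `B` with sum at most `r`. -/
def newtonIndices (B : Finset ι) (r : ℕ) : Finset (ι → ℕ) :=
  (Fintype.piFinset fun i => if i ∈ B then Finset.range (r + 1) else {0}).filter
    fun γ => ∑ i ∈ B, γ i ≤ r

theorem mem_newtonIndices {B : Finset ι} {r : ℕ} {γ : ι → ℕ} :
    γ ∈ newtonIndices B r ↔ (∀ i ∉ B, γ i = 0) ∧ ∑ i ∈ B, γ i ≤ r := by
  simp only [newtonIndices, Finset.mem_filter, Fintype.mem_piFinset]
  constructor
  · rintro ⟨h, h'⟩
    refine ⟨fun i hi => ?_, h'⟩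
    have := h i
    rwa [if_neg hi, Finset.mem_singleton] at this
  · rintro ⟨h, h'⟩
    refine ⟨fun i => ?_, h'⟩
    split_ifs with hi
    · exact Finset.mem_range.2 (Nat.lt_succ_of_le
        ((Finset.single_le_sum (f := γ) (fun _ _ => Nat.zero_le _) hi).trans h'))
    · exact Finset.mem_singleton.2 (h i hi)

/-- `newtonPt` in the coordinates in `B`, the identity in the others. -/
def newtonPtOn (a : ι → K → ℕ → K) (B : Finset ι) (γ : ι → ℕ) (i : ι) :
    (K →₀ K) →ₗ[K] (K →₀ K) :=
  if i ∈ B then newtonPt (a i) (γ i) else LinearMap.id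

/-- Newton interpolation of total degree at most `r` in the variables in `B`, with nodes `a i t`
which may depend on the point. -/
def interp (a : ι → K → ℕ → K) (B : Finset ι) (r : ℕ) (h : (ι → K) → E) (x : ι → K) : E :=
  ∑ γ ∈ newtonIndices B r, tensorEval h fun i => newtonPtOn a B γ i (Finsupp.single (x i) 1)

theorem tensorEval_interp (a : ι → K → ℕ → K) (B : Finset ι) (r : ℕ) (h : (ι → K) → E) :
    tensorEval (interp a B r h) =
      ∑ γ ∈ newtonIndices B r, (tensorEval h).compLinearMap (newtonPtOn a B γ) :=
  tensorEval_eq_of_point _ _ fun x => by simp [interp]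

theorem interp_sub (a : ι → K → ℕ → K) (B : Finset ι) (r : ℕ) (f g : (ι → K) → E) :
    interp a B r (f - g) = interp a B r f - interp a B r g := by
  ext x
  simp [interp, tensorEval_sub]

/-- Nodes that are constant on the grid make the interpolant an honest Newton polynomial in the
variables of `B`, so each term factors into scalars times a divided difference of `h` at the nodes.
-/
theorem gdq_interp (a : ι → K → ℕ → K) (B : Finset ι) (r : ℕ) (h : (ι → K) → E)
    {X : ι → Finset K} {b : ι → ℕ → K} (hb : ∀ i ∈ B, ∀ u ∈ X i, a i u = b i) :
    gdq (interp a B r h) X = ∑ γ ∈ newtonIndices B r,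
      (∏ i ∈ B, dq (newton (b i) (γ i)) (X i)) •
        gdq h fun i => if i ∈ B then nodeSet (b i) (γ i) else X i := by
  rw [gdq, tensorEval_interp, sum_apply]
  refine Finset.sum_congr rfl fun γ _ => ?_
  rw [MultilinearMap.compLinearMap_apply]
  have : (fun i => newtonPtOn a B γ i (dd (X i))) = fun i =>
      (if i ∈ B then dq (newton (b i) (γ i)) (X i) else 1) •
        dd (if i ∈ B then nodeSet (b i) (γ i) else X i) := by
    ext1 i
    by_cases hi : i ∈ B
    · simp [newtonPtOn, hi, newtonPt_dd _ (hb i hi)]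
    · simp [newtonPtOn, hi]
  rw [this, MultilinearMap.map_smul_univ, gdq]
  congr 1
  rw [Finset.prod_ite_mem, Finset.univ_inter]

/-- If only the summand with index `γ = β` contributes. -/
theorem gdq_interp_eq (a : ι → K → ℕ → K) (B : Finset ι) (r : ℕ) (h : (ι → K) → E)
    {X : ι → Finset K} (hX : ∀ i, (X i).Nonempty)
    {b : ι → ℕ → K} (hb : ∀ i ∈ B, ∀ u ∈ X i, a i u = b i)
    (hr : ∑ i ∈ B, gridOrder X i ≤ r)
    (hz : ∀ γ ∈ newtonIndices B r, (∃ i ∈ B, γ i ≠ gridOrder X i) →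
      ∃ i ∈ B, dq (newton (b i) (γ i)) (X i) = 0) :
    gdq (interp a B r h) X = gdq h fun i => if i ∈ B then nodeSet (b i) (gridOrder X i) else X i := by
  rw [gdq_interp a B r h hb, Finset.sum_eq_single fun i => if i ∈ B then gridOrder X i else 0]
  · rw [Finset.prod_eq_one, one_smul]
    · congr 1
      ext1 i
      by_cases hi : i ∈ B <;> simp [hi]
    · intro i hi
      simp only [hi, if_true]
      exact dq_newton_of_eq _ (gridOrder_add_one (hX i)).symm
  · intro γ hγ hne
    obtain ⟨i, hi, h0⟩ := hz γ hγ (by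
      by_contra! hcon
      refine hne (funext fun i => ?_)
      by_cases hi : i ∈ B
      · simp [hi, hcon i hi]
      · simp [hi, (mem_newtonIndices.1 hγ).1 i hi])
    rw [Finset.prod_eq_zero hi h0, zero_smul]
  · intro hn
    refine absurd (mem_newtonIndices.2 ⟨fun i hi => by simp [hi], ?_⟩) hn
    refine le_trans (le_of_eq ?_) hr
    exact Finset.sum_congr rfl fun i hi => by simp [hi]

/-- The grids in `∏ G i` on which divided differences of order in `N` can be formed. -/
structure IsGrid (G : ι → Set K) (N : Set (ι → ℕ)) (X : ι → Finset K) : Prop where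
  nonempty : ∀ i, (X i).Nonempty
  subset : ∀ i, ∀ u ∈ X i, u ∈ G i
  order_mem : gridOrder X ∈ N

/-- Nodes in each ball of radius `‖ρ‖` around a point of `G i`. -/
structure IsNodes (ρ : K) (G : ι → Set K) (a : ι → K → ℕ → K) : Prop where
  inj : ∀ i, ∀ t ∈ G i, Function.Injective (a i t)
  mem : ∀ i, ∀ t ∈ G i, ∀ m, a i t m ∈ G i
  near : ∀ i, ∀ t ∈ G i, ∀ m, ‖a i t m - t‖ ≤ ‖ρ‖
  congr : ∀ i t t', ‖t - t'‖ ≤ ‖ρ‖ → a i t = a i t'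

/-- The index set `N` consists of multi-indices with `|β_B| ≤ r`, with no other constraint on
the entries in `B`. -/
structure IsBlock (N : Set (ι → ℕ)) (B : Finset ι) (r : ℕ) : Prop where
  le : ∀ β ∈ N, ∑ i ∈ B, β i ≤ r
  succ : ∀ β ∈ N, ∀ i ∈ B, ∑ i ∈ B, β i < r → Function.update β i (β i + 1) ∈ N

/-- All divided differences of order in `N` are in `M`. -/
def HasGdqIn (M : AddSubgroup E) (G : ι → Set K) (N : Set (ι → ℕ)) (h : (ι → K) → E) : Prop :=
  ∀ X, IsGrid G N X → gdq h X ∈ M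

/-- Divided differences of order in `N` vary in `M` if the points in the directions of `B` move
in a ball of radius `‖ρ‖`. -/
def HasGdqVariationIn (M : AddSubgroup E) (G : ι → Set K) (N : Set (ι → ℕ)) (ρ : K) (B : Finset ι)
    (h : (ι → K) → E) : Prop :=
  ∀ X Y, IsGrid G N X → IsGrid G N Y → (∀ i ∉ B, X i = Y i) →
    (∀ i ∈ B, (X i).card = (Y i).card ∧ ∀ u ∈ X i, ∀ v ∈ Y i, ‖u - v‖ ≤ ‖ρ‖) →
      gdq h X - gdq h Y ∈ M

theorem HasGdqIn.variation {M : AddSubgroup E} {G : ι → Set K} {N : Set (ι → ℕ)}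
    {h : (ι → K) → E} (hh : HasGdqIn M G N h) (ρ : K) (B : Finset ι) :
    HasGdqVariationIn M G N ρ B h := fun X Y hX hY _ _ => M.sub_mem (hh X hX) (hh Y hY)

variable [IsUltrametricDist K]

theorem norm_sub_le_of_norm_sub_le {u v t : K} {r : ℝ} (hu : ‖u - t‖ ≤ r) (hv : ‖v - t‖ ≤ r) :
    ‖u - v‖ ≤ r := by
  rw [← dist_eq_norm] at *
  exact (dist_triangle_max u t v).trans (max_le hu (dist_comm t v ▸ hv))

/-- Induction on the defect `k` of the order of `X` from the maximal order `r` in the block. At `k =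
0` the error is a variation of divided differences of `h`. For larger `k`, points of `X` are
exchanged for nodes, on which the interpolation is exact; each exchange costs a factor of norm at
most `‖ρ‖` times an error of defect `k - 1`. -/
theorem interp_local {M : AddSubgroup E} (hM : ∀ c : K, ‖c‖ ≤ 1 → ∀ x ∈ M, c • x ∈ M)
    {ρ : K} {G : ι → Set K} {a : ι → K → ℕ → K} (ha : IsNodes ρ G a)
    {N : Set (ι → ℕ)} {B : Finset ι} {r : ℕ} (hN : IsBlock N B r)
    {h : (ι → K) → E} (hh : HasGdqVariationIn M G N ρ B h) (k : ℕ) (X : ι → Finset K)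
    (hX : IsGrid G N X) (t : ι → K) (ht : ∀ i, t i ∈ G i)
    (hXt : ∀ i ∈ B, ∀ u ∈ X i, ‖u - t i‖ ≤ ‖ρ‖) (hk : ∑ i ∈ B, gridOrder X i + k = r) :
    (ρ⁻¹) ^ k • gdq (h - interp a B r h) X ∈ M := by
  classical
  have hb : ∀ Y : ι → Finset K, (∀ i ∈ B, ∀ u ∈ Y i, ‖u - t i‖ ≤ ‖ρ‖) →
      ∀ i ∈ B, ∀ u ∈ Y i, a i u = a i (t i) :=
    fun Y hY i hi u hu => ha.congr i u (t i) (hY i hi u hu)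
  have hnode : ∀ i m, ∀ v ∈ nodeSet (a i (t i)) m, v ∈ G i ∧ ‖v - t i‖ ≤ ‖ρ‖ := by
    intro i m v hv
    obtain ⟨l, -, rfl⟩ := Finset.mem_image.1 hv
    exact ⟨ha.mem i _ (ht i) l, ha.near i _ (ht i) l⟩
  induction k generalizing X with
  | zero =>
    rw [pow_zero, one_smul, gdq_sub, gdq_interp_eq a B r h hX.nonempty (hb X hXt) (by omega)]
    · have hY : ∀ i, ((fun i => if i ∈ B then nodeSet (a i (t i)) (gridOrder X i) else X i) i).card
          = (X i).card := by
        intro i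
        by_cases hi : i ∈ B
        · simp only [hi, if_true]
          rw [card_nodeSet (ha.inj i _ (ht i)), gridOrder_add_one (hX.nonempty i)]
        · simp [hi]
      refine hh _ _ hX ⟨fun i => ?_, fun i u hu => ?_, ?_⟩ (fun i hi => by simp [hi]) ?_
      · exact Finset.card_pos.1 ((hY i).symm ▸ (hX.nonempty i).card_pos)
      · by_cases hi : i ∈ B
        · simp only [hi, if_true] at hu
          exact (hnode i _ u hu).1
        · simp only [hi, if_false] at hu
          exact hX.subset i u hu
      · convert hX.order_mem using 1
        ext1 i
        rw [gridOrder, hY, gridOrder]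
      · intro i hi
        refine ⟨(hY i).symm, fun u hu v hv => ?_⟩
        simp only [hi, if_true] at hv
        have h1 := hXt i hi u hu
        have h2 := (hnode i _ v hv).2
        exact norm_sub_le_of_norm_sub_le h1 h2
    -- If no factor vanished, degree considerations would give `γ ≥ gridOrder X` on `B`; then `|γ| ≤
    -- r`, with `r` the order of `X` on `B`, forces equality.
    · rintro γ hγ ⟨i, hi, hne⟩
      by_contra! hcon
      have hge : ∀ i ∈ B, gridOrder X i ≤ γ i := by
        intro i hi
        by_contra! hlt
        refine hcon i hi (dq_newton_of_lt _ ?_)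
        have := gridOrder_add_one (hX.nonempty i)
        omega
      have := Finset.sum_lt_sum hge ⟨i, hi, lt_of_le_of_ne (hge i hi) (Ne.symm hne)⟩
      have := (mem_newtonIndices.1 hγ).2
      omega
  | succ k ih =>
    -- Inner induction on the number of points of `X` that are not among the first nodes.
    induction' hn : ∑ i ∈ B, (X i \ nodeSet (a i (t i)) (gridOrder X i)).card
      using Nat.strong_induction_on with n ihn generalizing X
    have hcard : ∀ i, (nodeSet (a i (t i)) (gridOrder X i)).card = (X i).card := fun i => by
      rw [card_nodeSet (ha.inj i _ (ht i)), gridOrder_add_one (hX.nonempty i)]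
    by_cases hsub : ∀ i ∈ B, X i ⊆ nodeSet (a i (t i)) (gridOrder X i)
    · have heq : ∀ i ∈ B, X i = nodeSet (a i (t i)) (gridOrder X i) := fun i hi =>
        Finset.eq_of_subset_of_card_le (hsub i hi) (hcard i).le
      rw [gdq_sub, gdq_interp_eq a B r h hX.nonempty (hb X hXt) (by omega)]
      · have : (fun i => if i ∈ B then nodeSet (a i (t i)) (gridOrder X i) else X i) = X := by
          ext1 i
          by_cases hi : i ∈ B
          · simp only [hi, if_true]; exact (heq i hi).symm
          · simp [hi]
        rw [this, sub_self, smul_zero]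
        exact M.zero_mem
      · rintro γ hγ ⟨i, hi, hne⟩
        refine ⟨i, hi, ?_⟩
        -- Here no bound by the total degree is needed: too small a `γ i` is excluded by degree, too
        -- large a `γ i` because the Newton polynomial vanishes at all points of `X i`.
        rcases lt_or_gt_of_ne hne with hlt | hgt
        · have := gridOrder_add_one (hX.nonempty i)
          exact dq_newton_of_lt _ (by omega)
        · refine dq_newton_nodes _ hgt fun u hu => ?_
          obtain ⟨l, hl, rfl⟩ := Finset.mem_image.1 (hsub i hi hu)
          exact ⟨l, by have := Finset.mem_range.1 hl; omega, rfl⟩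
    · push Not at hsub
      obtain ⟨i, hi, hsub⟩ := hsub
      obtain ⟨u, hu, huA⟩ := Finset.not_subset.1 hsub
      obtain ⟨v, hvA, hv⟩ : ∃ v ∈ nodeSet (a i (t i)) (gridOrder X i), v ∉ X i := by
        by_contra! hcon
        have := Finset.eq_of_subset_of_card_le hcon (hcard i).ge
        exact huA (this ▸ hu)
      have huv : u ≠ v := fun e => hv (e ▸ hu)
      -- `X'` adds the node `v` and has order one higher; `X''` also drops `u`, so it has the order
      -- of `X` but one fewer point outside the nodes. Then `F[X] = F[X''] + (u - v) F[X']`.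
      set X' := Function.update X i (insert v (X i)) with hX'
      have hX'i : X' i = insert v (X i) := by simp [hX']
      have hX'k : ∀ k, k ≠ i → X' k = X k := fun k hk => by simp [hX', hk]
      have key := gdq_erase_sub_erase (h - interp a B r h) (X := X') (i := i)
        (u := u) (v := v) (by simp [hX'i, hu]) (by simp [hX'i]) huv
      rw [hX'i, Finset.erase_insert hv] at key
      have e1 : Function.update X' i (X i) = X := by simp [hX']
      set X'' := Function.update X' i ((insert v (X i)).erase u) with hX''
      have hX''i : X'' i = (insert v (X i)).erase u := by simp [hX'']
      have hX''k : ∀ k, k ≠ i → X'' k = X k := fun k hk => by simp [hX'', hX'k k hk, hk]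
      rw [e1] at key
      have hc' : (X' i).card = (X i).card + 1 := by rw [hX'i, Finset.card_insert_of_notMem hv]
      have hc'' : (X'' i).card = (X i).card := by
        rw [hX''i, Finset.card_erase_of_mem (by simp [hu]), Finset.card_insert_of_notMem hv]
        rfl
      have ho'' : gridOrder X'' = gridOrder X := by
        ext1 k
        rcases eq_or_ne k i with rfl | hk
        · simp [gridOrder, hc'']
        · simp [gridOrder, hX''k k hk]
      have ho' : gridOrder X' = Function.update (gridOrder X) i (gridOrder X i + 1) := by
        ext1 k
        rcases eq_or_ne k i with rfl | hk
        · have := gridOrder_add_one (hX.nonempty k)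
          simp only [gridOrder, Function.update_self] at this ⊢
          omega
        · simp [gridOrder, hX'k k hk, hk]
      have hso' : ∑ j ∈ B, gridOrder X' j = ∑ j ∈ B, gridOrder X j + 1 := by
        rw [← Finset.add_sum_erase _ _ hi, ← Finset.add_sum_erase B (gridOrder X) hi, ho']
        have : ∑ j ∈ B.erase i, Function.update (gridOrder X) i (gridOrder X i + 1) j =
            ∑ j ∈ B.erase i, gridOrder X j :=
          Finset.sum_congr rfl fun j hj => by simp [(Finset.mem_erase.1 hj).1]
        rw [this, Function.update_self]
        ring
      have hmem' : ∀ k, ∀ w ∈ X' k, w ∈ G k ∧ (k ∈ B → ‖w - t k‖ ≤ ‖ρ‖) := by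
        intro k w hw
        rcases eq_or_ne k i with rfl | hk
        · rw [hX'i, Finset.mem_insert] at hw
          rcases hw with rfl | hw
          · exact ⟨(hnode k _ w hvA).1, fun _ => (hnode k _ w hvA).2⟩
          · exact ⟨hX.subset k w hw, fun hk => hXt k hk w hw⟩
        · rw [hX'k k hk] at hw
          exact ⟨hX.subset k w hw, fun hk => hXt k hk w hw⟩
      have hsub'' : ∀ k, X'' k ⊆ X' k := by
        intro k
        rcases eq_or_ne k i with rfl | hk
        · rw [hX''i, hX'i]; exact Finset.erase_subset _ _
        · rw [hX''k k hk, hX'k k hk]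
      have hg' : IsGrid G N X' := by
        refine ⟨fun k => ?_, fun k w hw => (hmem' k w hw).1, ?_⟩
        · rcases eq_or_ne k i with rfl | hk
          · rw [hX'i]; exact Finset.insert_nonempty _ _
          · rw [hX'k k hk]; exact hX.nonempty k
        · rw [ho']
          exact hN.succ _ hX.order_mem i hi (by omega)
      have hg'' : IsGrid G N X'' := by
        refine ⟨fun k => ?_, fun k w hw => (hmem' k w (hsub'' k hw)).1, ho'' ▸ hX.order_mem⟩
        rcases eq_or_ne k i with rfl | hk
        · exact Finset.card_pos.1 (hc'' ▸ (hX.nonempty k).card_pos)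
        · rw [hX''k k hk]; exact hX.nonempty k
      have m' := ih X' hg' (fun k hk w hw => (hmem' k w hw).2 hk) (by omega)
      have m'' := ihn _ (by
        rw [← hn]
        refine Finset.sum_lt_sum (fun k _ => ?_) ⟨i, hi, ?_⟩
        · rw [ho'']
          rcases eq_or_ne k i with rfl | hk
          · refine Finset.card_le_card fun w hw => ?_
            rw [hX''i] at hw
            simp only [Finset.mem_sdiff, Finset.mem_erase, Finset.mem_insert] at hw ⊢
            refine ⟨hw.1.2.resolve_left ?_, hw.2⟩
            rintro rfl
            exact hw.2 hvA
          · rw [hX''k k hk]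
        · rw [ho'']
          refine Finset.card_lt_card (Finset.ssubset_iff_of_subset (fun w hw => ?_) |>.2
            ⟨u, by simp [hu, huA], by simp [hX''i]⟩)
          rw [hX''i] at hw
          simp only [Finset.mem_sdiff, Finset.mem_erase, Finset.mem_insert] at hw ⊢
          refine ⟨hw.1.2.resolve_left ?_, hw.2⟩
          rintro rfl
          exact hw.2 hvA) X'' hg'' (fun k hk w hw => (hmem' k w (hsub'' k hw)).2 hk)
        (by rw [ho'']; omega) rfl
      have e : (ρ⁻¹) ^ (k + 1) • gdq (h - interp a B r h) X =
          (ρ⁻¹) ^ (k + 1) • gdq (h - interp a B r h) X'' +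
          ((u - v) * ρ⁻¹) • (ρ⁻¹) ^ k • gdq (h - interp a B r h) X' := by
        rw [eq_add_of_sub_eq key.symm, smul_add, smul_smul, smul_smul, add_comm]
        congr 2
        ring
      rw [e]
      refine M.add_mem m'' (hM _ ?_ _ m')
      rw [norm_mul, norm_inv, ← div_eq_mul_inv]
      refine div_le_one_of_le₀ ?_ (norm_nonneg _)
      exact norm_sub_le_of_norm_sub_le (hXt i hi u hu) (hnode i _ v hvA).2

/-- The interpolation error is small if the divided differences of `h` vary little. -/
theorem interp_error {M : AddSubgroup E} (hM : ∀ c : K, ‖c‖ ≤ 1 → ∀ x ∈ M, c • x ∈ M)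
    {ρ : K} (hρ : ρ ≠ 0) (hρ1 : ‖ρ‖ ≤ 1) {G : ι → Set K} {a : ι → K → ℕ → K} (ha : IsNodes ρ G a)
    {N : Set (ι → ℕ)} (hlow : IsLowerSet N) {B : Finset ι} {r : ℕ} (hN : IsBlock N B r)
    {h : (ι → K) → E} (hh : HasGdqVariationIn M G N ρ B h) :
    HasGdqIn M G N (h - interp a B r h) := by
  intro X hX
  refine smul_pow_inv_mem hM hρ hρ1
    (gdq_mem_of_local hM hρ (B := B) (r := r) (Q := IsGrid G N) (fun X hX => hX.nonempty)
      (fun X Y hX hYX hY => ⟨hY, fun i u hu => hX.subset i u (hYX i hu),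
        hlow (gridOrder_mono hYX) hX.order_mem⟩)
      -- A grid of diameter at most `‖ρ‖` in the directions of `B` lies in one ball around any of
      -- its points there, so `interp_local` applies with `k = r - |order|`.
      (fun X hX => hN.le _ hX.order_mem) (fun X hX hl => ?_) X hX)
  choose t ht using hX.nonempty
  exact interp_local hM ha hN hh _ X hX t (fun i => hX.subset i _ (ht i))
    (fun i hi u hu => hl i hi u hu (t i) (ht i)) (Nat.add_sub_cancel' (hN.le _ hX.order_mem))

/-- Interpolation preserves bounds on divided differences, as both `h` and the error `h - interp h`
satisfy them. -/
theorem interp_hasGdqIn {M : AddSubgroup E} (hM : ∀ c : K, ‖c‖ ≤ 1 → ∀ x ∈ M, c • x ∈ M)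
    {ρ : K} (hρ : ρ ≠ 0) (hρ1 : ‖ρ‖ ≤ 1) {G : ι → Set K} {a : ι → K → ℕ → K} (ha : IsNodes ρ G a)
    {N : Set (ι → ℕ)} (hlow : IsLowerSet N) {B : Finset ι} {r : ℕ} (hN : IsBlock N B r)
    {h : (ι → K) → E} (hh : HasGdqIn M G N h) : HasGdqIn M G N (interp a B r h) := by
  intro X hX
  have := M.sub_mem (hh X hX) (interp_error hM hρ hρ1 ha hlow hN (hh.variation ρ B) X hX)
  rwa [gdq_sub, sub_sub_cancel] at this

/-- Successive interpolation in several blocks of variables. -/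
theorem foldr_interp_error {M : AddSubgroup E} (hM : ∀ c : K, ‖c‖ ≤ 1 → ∀ x ∈ M, c • x ∈ M)
    {ρ : K} (hρ : ρ ≠ 0) (hρ1 : ‖ρ‖ ≤ 1) {G : ι → Set K} {a : ι → K → ℕ → K} (ha : IsNodes ρ G a)
    {N : Set (ι → ℕ)} (hlow : IsLowerSet N) {h : (ι → K) → E} {J : Type*} {B : J → Finset ι}
    {r : J → ℕ} (hl : ∀ j, IsBlock N (B j) (r j))
    (hh : ∀ j, HasGdqVariationIn M G N ρ (B j) h) (l : List J) :
    HasGdqIn M G N (h - l.foldr (fun j g => interp a (B j) (r j) g) h) := by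
  induction l with
  | nil =>
    intro X _
    rw [List.foldr_nil, gdq_sub, sub_self]
    exact M.zero_mem
  | cons j l ih =>
    intro X hX
    -- With `I` the interpolation in block `j` and `g` the result for the remaining blocks: `h - I g
    -- = (h - I h) + I (h - g)`.
    have h1 := interp_error hM hρ hρ1 ha hlow (hl j) (hh j) X hX
    have h2 := interp_hasGdqIn hM hρ hρ1 ha hlow (hl j) ih X hX
    have := M.add_mem h1 h2
    rwa [← gdq_add, interp_sub, sub_add_sub_cancel] at this

end Interpolation

/-! ### Polynomial functions and locally polynomial approximants. -/

section LocallyPolynomial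

variable {K : Type*} [NormedField K] {ι : Type*} [Fintype ι] [DecidableEq ι]
variable {E : Type*} [AddCommGroup E] [Module K E]

variable (K ι E) in
/-- The additive group of polynomial functions on `K^n` with values in `E`. -/
def polynomialFun : AddSubgroup ((ι → K) → E) :=
  AddSubgroup.closure {p | ∃ (β : ι → ℕ) (e : E), p = fun x => (∏ i, x i ^ β i) • e}

theorem monomial_mem_polynomialFun (β : ι → ℕ) (e : E) :
    (fun x : ι → K => (∏ i, x i ^ β i) • e) ∈ polynomialFun K ι E :=
  AddSubgroup.subset_closure ⟨β, e, rfl⟩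

theorem prod_eval_smul_mem_polynomialFun (q : ι → Polynomial K) (e : E) :
    (fun x : ι → K => (∏ i, (q i).eval (x i)) • e) ∈ polynomialFun K ι E := by
  have : (fun x : ι → K => (∏ i, (q i).eval (x i)) • e) =
      ∑ β ∈ Fintype.piFinset fun i => Finset.range ((q i).natDegree + 1),
        fun x : ι → K => (∏ i, x i ^ β i) • ((∏ i, (q i).coeff (β i)) • e) := by
    ext x
    simp only [Polynomial.eval_eq_sum_range, Finset.prod_univ_sum, Finset.sum_smul, smul_smul,
      Finset.sum_apply, ← Finset.prod_mul_distrib]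
    exact Finset.sum_congr rfl fun β _ => by simp only [mul_comm]
  rw [this]
  exact AddSubgroup.sum_mem _ fun β _ => monomial_mem_polynomialFun β _

theorem exists_finsupp_of_mem_polynomialFun {p : (ι → K) → E} (hp : p ∈ polynomialFun K ι E) :
    ∃ a : (ι → ℕ) →₀ E, ∀ x, p x = a.sum fun β c => (∏ i, x i ^ β i) • c := by
  classical
  induction hp using AddSubgroup.closure_induction with
  | mem p hp =>
    obtain ⟨β, e, rfl⟩ := hp
    exact ⟨Finsupp.single β e, fun x => by simp⟩
  | zero => exact ⟨0, fun x => by simp⟩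
  | add p q _ _ hp hq =>
    obtain ⟨a, ha⟩ := hp
    obtain ⟨b, hb⟩ := hq
    refine ⟨a + b, fun x => ?_⟩
    rw [Finsupp.sum_add_index' (by simp) (by simp [smul_add]), ← ha, ← hb, Pi.add_apply]
  | neg p _ hp =>
    obtain ⟨a, ha⟩ := hp
    refine ⟨-a, fun x => ?_⟩
    rw [Finsupp.sum_neg_index (by simp), Pi.neg_apply, ha]
    simp [Finsupp.sum]

/-- `g` is a polynomial function on each polydisc of radius `‖ρ‖`. -/
def IsLocallyPolynomial (ρ : K) (g : (ι → K) → E) : Prop :=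
  ∀ c : ι → K, ∃ p ∈ polynomialFun K ι E, ∀ x : ι → K, (∀ i, ‖x i - c i‖ ≤ ‖ρ‖) → g x = p x

/-- The Newton term with index `γ` in the variables in `S`. -/
def newtonTerm (a : ι → K → ℕ → K) (h : (ι → K) → E) (S : Finset ι) (γ : ι → ℕ) (x : ι → K) : E :=
  tensorEval h fun i => newtonPtOn a S γ i (Finsupp.single (x i) 1)

theorem tensorEval_newtonTerm (a : ι → K → ℕ → K) (h : (ι → K) → E) (S : Finset ι) (γ : ι → ℕ) :
    tensorEval (newtonTerm a h S γ) = (tensorEval h).compLinearMap (newtonPtOn a S γ) :=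
  tensorEval_eq_of_point _ _ fun x => by simp [newtonTerm]

/-- Interpolations in disjoint sets of variables act on different tensor factors, so they compose to
Newton terms in the union. -/
theorem interp_newtonTerm (a : ι → K → ℕ → K) (h : (ι → K) → E) {S B : Finset ι}
    (hSB : Disjoint B S) (r : ℕ) (γ : ι → ℕ) :
    interp a B r (newtonTerm a h S γ) = ∑ γ' ∈ newtonIndices B r,
      newtonTerm a h (B ∪ S) fun i => if i ∈ B then γ' i else γ i := by
  ext x
  rw [interp, Finset.sum_apply]
  refine Finset.sum_congr rfl fun γ' _ => ?_
  rw [tensorEval_newtonTerm, MultilinearMap.compLinearMap_apply, newtonTerm]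
  congr 1
  ext1 i
  by_cases hi : i ∈ B
  · have : i ∉ S := Finset.disjoint_left.1 hSB hi
    simp [newtonPtOn, hi, this]
  · simp [newtonPtOn, hi]

/-- Once all blocks have been treated, only Newton terms in all the treated variables remain; if
these are all variables, the function is locally polynomial. -/
theorem foldr_interp_mem (a : ι → K → ℕ → K) (h : (ι → K) → E) {J : Type*} [DecidableEq J]
    {B : J → Finset ι} (hB : Pairwise fun j k => Disjoint (B j) (B k)) (r : J → ℕ) (l : List J)
    (hl : l.Nodup) :
    l.foldr (fun j g => interp a (B j) (r j) g) h ∈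
      AddSubgroup.closure (Set.range (newtonTerm a h (l.toFinset.biUnion B))) := by
  induction l with
  | nil =>
    refine AddSubgroup.subset_closure ⟨0, ?_⟩
    ext x
    simp [newtonTerm, newtonPtOn, tensorEval_point]
  | cons j l ih =>
    rw [List.nodup_cons] at hl
    rw [List.foldr_cons, List.toFinset_cons, Finset.biUnion_insert]
    have hd : Disjoint (B j) (l.toFinset.biUnion B) := by
      rw [Finset.disjoint_biUnion_right]
      intro k hk
      exact hB fun e => hl.1 (by simpa [← e] using hk)
    have := ih hl.2
    revert this
    generalize l.foldr (fun j g => interp a (B j) (r j) g) h = g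
    intro hg
    induction hg using AddSubgroup.closure_induction with
    | mem g hg =>
      obtain ⟨γ, rfl⟩ := hg
      rw [interp_newtonTerm a h hd]
      exact AddSubgroup.sum_mem _ fun γ' _ => AddSubgroup.subset_closure ⟨_, rfl⟩
    | zero =>
      have := interp_sub a (B j) (r j) (0 : (ι → K) → E) 0
      rw [sub_self, sub_self] at this
      rw [this]
      exact AddSubgroup.zero_mem _
    | add g g' _ _ hg hg' =>
      have := interp_sub a (B j) (r j) (g + g') g'
      rw [add_sub_cancel_right] at this
      rw [eq_add_of_sub_eq this.symm]
      exact AddSubgroup.add_mem _ hg hg'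
    | neg g _ hg =>
      have h0 := interp_sub a (B j) (r j) (0 : (ι → K) → E) 0
      rw [sub_self, sub_self] at h0
      have := interp_sub a (B j) (r j) 0 g
      rw [h0, zero_sub, zero_sub] at this
      rw [this]
      exact AddSubgroup.neg_mem _ hg

theorem newton_eq_eval (b : ℕ → K) (m : ℕ) (t : K) :
    newton b m t = (∏ k ∈ Finset.range m, (Polynomial.X - Polynomial.C (b k))).eval t := by
  simp [newton, Polynomial.eval_prod]

/-- On a polydisc of radius `‖ρ‖` the nodes are constant, and the term is a product of Newton
polynomials times a fixed divided difference of `h`. -/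
theorem isLocallyPolynomial_newtonTerm {ρ : K} {a : ι → K → ℕ → K}
    (ha : ∀ i t t', ‖t - t'‖ ≤ ‖ρ‖ → a i t = a i t') (h : (ι → K) → E) (γ : ι → ℕ) :
    IsLocallyPolynomial ρ (newtonTerm a h Finset.univ γ) := by
  intro c
  refine ⟨_, prod_eval_smul_mem_polynomialFun
    (fun i => ∏ k ∈ Finset.range (γ i), (Polynomial.X - Polynomial.C (a i (c i) k)))
    (gdq h fun i => nodeSet (a i (c i)) (γ i)), fun x hx => ?_⟩
  have : (fun i => newtonPtOn a Finset.univ γ i (Finsupp.single (x i) 1)) = fun i =>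
      newton (a i (c i)) (γ i) (x i) • dd (nodeSet (a i (c i)) (γ i)) := by
    ext1 i
    simp [newtonPtOn, newtonPt_single, ha i _ _ (hx i)]
  simp only [← newton_eq_eval]
  rw [newtonTerm, this, MultilinearMap.map_smul_univ, gdq]

theorem isLocallyPolynomial_of_mem_closure {ρ : K} {S : Set ((ι → K) → E)}
    (hS : ∀ g ∈ S, IsLocallyPolynomial ρ g) {g : (ι → K) → E} (hg : g ∈ AddSubgroup.closure S) :
    IsLocallyPolynomial ρ g := by
  induction hg using AddSubgroup.closure_induction with
  | mem g hg => exact hS g hg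
  | zero => exact fun c => ⟨0, AddSubgroup.zero_mem _, fun _ _ => rfl⟩
  | add f g _ _ hf hg =>
    intro c
    obtain ⟨p, hp, hp'⟩ := hf c
    obtain ⟨q, hq, hq'⟩ := hg c
    exact ⟨p + q, AddSubgroup.add_mem _ hp hq, fun x hx => by simp [hp' x hx, hq' x hx]⟩
  | neg f _ hf =>
    intro c
    obtain ⟨p, hp, hp'⟩ := hf c
    exact ⟨-p, AddSubgroup.neg_mem _ hp, fun x hx => by simp [hp' x hx]⟩

open Classical in
/-- A sequence of distinct elements of an infinite set. -/
def seqOf (S : Set K) (m : ℕ) : K := if h : S.Infinite then Set.Infinite.natEmbedding S h m else 0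

theorem seqOf_mem {S : Set K} (h : S.Infinite) (m : ℕ) : seqOf S m ∈ S := by
  rw [seqOf, dif_pos h]
  exact (Set.Infinite.natEmbedding S h m).2

theorem seqOf_injective {S : Set K} (h : S.Infinite) : Function.Injective (seqOf S) := by
  intro m m' hm
  rw [seqOf, seqOf, dif_pos h, dif_pos h] at hm
  exact (Set.Infinite.natEmbedding S h).injective (Subtype.ext hm)

theorem closedBall_eq_of_norm_sub_le [IsUltrametricDist K] {t t' : K} {r : ℝ} (h : ‖t - t'‖ ≤ r) :
    Metric.closedBall t r = Metric.closedBall t' r := by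
  have : t ∈ Metric.closedBall t' r := by rwa [Metric.mem_closedBall, dist_eq_norm]
  exact (IsUltrametricDist.closedBall_eq_of_mem this).symm

/-- The nodes are chosen as a function of the set `G i ∩ closedBall t ‖ρ‖`. In an ultrametric field
this set is the same for all centres in the ball, so the choice is constant on balls. -/
theorem exists_isNodes [IsUltrametricDist K] {ρ : K} {G : ι → Set K}
    (hG : ∀ i, ∀ t ∈ G i, (G i ∩ Metric.closedBall t ‖ρ‖).Infinite) :
    ∃ a, IsNodes ρ G a := by
  refine ⟨fun i t => seqOf (G i ∩ Metric.closedBall t ‖ρ‖), ?_, ?_, ?_, ?_⟩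
  · exact fun i t ht => seqOf_injective (hG i t ht)
  · exact fun i t ht m => (seqOf_mem (hG i t ht) m).1
  · intro i t ht m
    have := (seqOf_mem (hG i t ht) m).2
    rwa [Metric.mem_closedBall, dist_eq_norm] at this
  · intro i t t' htt
    simp only [closedBall_eq_of_norm_sub_le htt]

/-- The multi-indices with `|β_j| ≤ r j` for each block of coordinates. -/
def blockSet {J : Type*} [DecidableEq J] (π : ι → J) (r : J → ℕ) : Set (ι → ℕ) :=
  {β | ∀ j, ∑ i with π i = j, β i ≤ r j}

theorem isLowerSet_blockSet {J : Type*} [DecidableEq J] (π : ι → J) (r : J → ℕ) :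
    IsLowerSet (blockSet π r) :=
  fun _ _ hle hβ j => (Finset.sum_le_sum fun i _ => hle i).trans (hβ j)

theorem isBlock_blockSet {J : Type*} [DecidableEq J] (π : ι → J) (r : J → ℕ) (j : J) :
    IsBlock (blockSet π r) (Finset.univ.filter fun i => π i = j) (r j) := by
  refine ⟨fun β hβ => hβ j, fun β hβ i hi hlt k => ?_⟩
  rcases eq_or_ne k j with rfl | hk
  · rw [← Finset.add_sum_erase _ _ hi, Function.update_self]
    rw [← Finset.add_sum_erase _ _ hi] at hlt
    have : ∑ l ∈ (Finset.univ.filter fun i => π i = k).erase i,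
        Function.update β i (β i + 1) l =
        ∑ l ∈ (Finset.univ.filter fun i => π i = k).erase i, β l :=
      Finset.sum_congr rfl fun l hl => by simp [(Finset.mem_erase.1 hl).1]
    omega
  · refine le_trans (le_of_eq (Finset.sum_congr rfl fun l hl => ?_)) (hβ k)
    have : l ≠ i := by
      rintro rfl
      simp only [Finset.mem_filter, Finset.mem_univ, true_and] at hi hl
      exact hk (hl.symm.trans hi)
    simp [this]

/-- Approximation by locally polynomial functions on a product `∏ G i`. -/
theorem exists_isLocallyPolynomial [IsUltrametricDist K] {M : AddSubgroup E}
    (hM : ∀ c : K, ‖c‖ ≤ 1 → ∀ x ∈ M, c • x ∈ M)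
    {ρ : K} (hρ : ρ ≠ 0) (hρ1 : ‖ρ‖ ≤ 1) {G : ι → Set K}
    (hG : ∀ i, ∀ t ∈ G i, (G i ∩ Metric.closedBall t ‖ρ‖).Infinite)
    {J : Type*} [Fintype J] [DecidableEq J] (π : ι → J) (r : J → ℕ) {h : (ι → K) → E}
    (hh : ∀ j, HasGdqVariationIn M G (blockSet π r) ρ (Finset.univ.filter fun i => π i = j) h) :
    ∃ g, IsLocallyPolynomial ρ g ∧ HasGdqIn M G (blockSet π r) (h - g) := by
  obtain ⟨a, ha⟩ := exists_isNodes hG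
  refine ⟨_, ?_, foldr_interp_error hM hρ hρ1 ha (isLowerSet_blockSet π r)
    (isBlock_blockSet π r) hh Finset.univ.toList⟩
  have := foldr_interp_mem a h (B := fun j => Finset.univ.filter fun i => π i = j)
    (fun j k hjk => Finset.disjoint_filter.2 fun i _ h1 h2 => hjk (h1.symm.trans h2)) r
    Finset.univ.toList (Finset.nodup_toList _)
  refine isLocallyPolynomial_of_mem_closure ?_ this
  rintro _ ⟨γ, rfl⟩
  have : (Finset.univ.toList (α := J)).toFinset.biUnion
      (fun j => Finset.univ.filter fun i => π i = j) = Finset.univ := by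
    ext i
    simp
  rw [this]
  exact isLocallyPolynomial_newtonTerm ha.congr h γ

end LocallyPolynomial

/-! ### A submultiplicative scale of bounds, and polynomials close to indicators of balls. -/

section OneVariableBounds

variable {K : Type*} [NormedField K]

/-- All divided differences of order `m` of `F` on `W` are bounded by `b / R ^ m`. -/
def HasDqBound (R : ℝ) (W : Set K) (F : K → K) (b : ℝ) : Prop :=
  ∀ X : Finset K, X.Nonempty → (∀ u ∈ X, u ∈ W) → ‖dq F X‖ * R ^ (X.card - 1) ≤ b

theorem HasDqBound.mono {R : ℝ} {W : Set K} {F : K → K} {b c : ℝ} (h : HasDqBound R W F b)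
    (hbc : b ≤ c) : HasDqBound R W F c := fun X hX hW => (h X hX hW).trans hbc

theorem HasDqBound.congr {R : ℝ} {W : Set K} {F G : K → K} {b : ℝ} (h : HasDqBound R W F b)
    (hFG : ∀ t ∈ W, G t = F t) : HasDqBound R W G b := fun X hX hW => by
  rw [dq_congr fun t ht => hFG t (hW t ht)]
  exact h X hX hW

theorem hasDqBound_const (R : ℝ) (W : Set K) (c : K) : HasDqBound R W (fun _ => c) ‖c‖ := by
  intro X hX _
  rcases Nat.lt_or_ge X.card 2 with h | h
  · obtain ⟨u, rfl⟩ := Finset.card_eq_one.1 (show X.card = 1 by have := hX.card_pos; omega)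
    simp
  · rw [dq_const _ h]
    simp

/-- Leibniz' rule: `(F G)[X]` for `G` with difference quotient `G_u(t) = (G(t) - G(u)) / (t - u)`. -/
theorem dq_mul [DecidableEq K] (F G : K → K) {X : Finset K} {u : K} (hu : u ∈ X) :
    dq (fun t => F t * G t) X =
      G u * dq F X + dq (fun t => F t * ((G t - G u) / (t - u))) (X.erase u) := by
  have h := dq_sub_mul (fun t => F t * ((G t - G u) / (t - u))) hu
  have e : X.erase u = @Finset.erase K (fun a b => Classical.propDecidable (a = b)) X u := by
    congr!
  rw [e, ← h, ← dq_const_mul, ← dq_add]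
  refine dq_congr fun t _ => ?_
  rcases eq_or_ne t u with rfl | htu
  · simp [mul_comm]
  · have := sub_ne_zero.2 htu
    field_simp
    ring

/-- Leibniz' rule applied to `1 · G`, in which the divided difference of the constant vanishes. -/
theorem dq_slope [DecidableEq K] (G : K → K) {X : Finset K} {u : K} (hu : u ∉ X)
    (hX : X.Nonempty) : dq (fun t => (G t - G u) / (t - u)) X = dq G (insert u X) := by
  have h := dq_mul (fun _ => 1) G (Finset.mem_insert_self u X)
  rw [Finset.erase_insert hu, dq_const 1 (by
    rw [Finset.card_insert_of_notMem hu]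
    have := hX.card_pos
    omega)] at h
  simp only [one_mul, mul_zero, zero_add] at h
  exact h.symm

variable [IsUltrametricDist K]

theorem norm_sub_le_max' (x y : K) : ‖x - y‖ ≤ max ‖x‖ ‖y‖ := by
  rw [sub_eq_add_neg, ← norm_neg y]
  exact IsUltrametricDist.norm_add_le_max _ _

theorem HasDqBound.add {R : ℝ} (hR : 0 ≤ R) {W : Set K} {F G : K → K} {b : ℝ}
    (hF : HasDqBound R W F b) (hG : HasDqBound R W G b) :
    HasDqBound R W (fun t => F t + G t) b := by
  intro X hX hW
  rw [dq_add]
  refine (mul_le_mul_of_nonneg_right (IsUltrametricDist.norm_add_le_max _ _) (by positivity)).trans ?_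
  rw [max_mul_of_nonneg _ _ (by positivity)]
  exact max_le (hF X hX hW) (hG X hX hW)

theorem HasDqBound.sub {R : ℝ} (hR : 0 ≤ R) {W : Set K} {F G : K → K} {b : ℝ}
    (hF : HasDqBound R W F b) (hG : HasDqBound R W G b) :
    HasDqBound R W (fun t => F t - G t) b := by
  intro X hX hW
  rw [dq_sub]
  refine (mul_le_mul_of_nonneg_right (norm_sub_le_max' _ _) (by positivity)).trans ?_
  rw [max_mul_of_nonneg _ _ (by positivity)]
  exact max_le (hF X hX hW) (hG X hX hW)

theorem HasDqBound.neg {R : ℝ} {W : Set K} {F : K → K} {b : ℝ} (hF : HasDqBound R W F b) :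
    HasDqBound R W (fun t => -F t) b := by
  intro X hX hW
  have := dq_const_mul (-1) F X
  simp only [neg_one_mul] at this
  rw [this, norm_neg]
  exact hF X hX hW

/-- Induction on the number of points by Leibniz' rule. The slope of `G` at `u` has the divided
differences of `G` of one order higher, hence bound `c / R`, which compensates the loss of one
point. -/
theorem norm_dq_mul_le {R : ℝ} (hR : 0 < R) {F : K → K} {b : ℝ} (hb : 0 ≤ b) {X : Finset K}
    (hX : X.Nonempty) (hF : ∀ Y ⊆ X, Y.Nonempty → ‖dq F Y‖ * R ^ (Y.card - 1) ≤ b)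
    {G : K → K} {c : ℝ} (hG : ∀ Y ⊆ X, Y.Nonempty → ‖dq G Y‖ * R ^ (Y.card - 1) ≤ c) :
    ‖dq (fun t => F t * G t) X‖ * R ^ (X.card - 1) ≤ b * c := by
  classical
  induction' hn : X.card using Nat.strong_induction_on with n ih generalizing X G c
  obtain ⟨u, hu⟩ := hX
  have hGu : ‖G u‖ ≤ c := by simpa using hG {u} (by simpa using hu) (by simp)
  have hc : 0 ≤ c := (norm_nonneg _).trans hGu
  have hce := Finset.card_erase_of_mem hu
  rcases Nat.lt_or_ge n 2 with h | h
  · obtain ⟨w, rfl⟩ := Finset.card_eq_one.1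
      (show X.card = 1 by have := Finset.card_pos.2 ⟨u, hu⟩; omega)
    obtain rfl := Finset.mem_singleton.1 hu
    have hFu : ‖F u‖ ≤ b := by simpa using hF {u} (by simp) (by simp)
    simp only [Finset.card_singleton] at hn
    subst hn
    simp only [dq_singleton, norm_mul, Nat.sub_self, pow_zero, mul_one]
    exact mul_le_mul hFu hGu (norm_nonneg _) hb
  · have hne : (X.erase u).Nonempty := Finset.card_pos.1 (by omega)
    have key := ih (n - 1) (by omega) hne
      (fun Y hY => hF Y (hY.trans (Finset.erase_subset _ _)))
      (G := fun t => (G t - G u) / (t - u)) (c := c / R) (fun Y hY hYne => by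
        have huY : u ∉ Y := fun h => by simpa using hY h
        rw [dq_slope G huY hYne, le_div_iff₀ hR]
        have := hG (insert u Y) (Finset.insert_subset hu (hY.trans (Finset.erase_subset _ _)))
          (Finset.insert_nonempty _ _)
        rw [Finset.card_insert_of_notMem huY, Nat.add_sub_cancel] at this
        rwa [mul_assoc, ← pow_succ, Nat.sub_add_cancel hYne.card_pos]) (by omega)
    rw [dq_mul F G hu]
    refine (mul_le_mul_of_nonneg_right (IsUltrametricDist.norm_add_le_max _ _)
      (by positivity)).trans ?_
    rw [max_mul_of_nonneg _ _ (by positivity)]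
    refine max_le ?_ ?_
    · rw [norm_mul, mul_assoc, mul_comm b c]
      have := hF X subset_rfl ⟨u, hu⟩
      rw [hn] at this
      exact mul_le_mul hGu this (by positivity) hc
    · have e : n - 1 = n - 1 - 1 + 1 := by omega
      rw [e, pow_succ, ← mul_assoc]
      rw [← mul_div_assoc, le_div_iff₀ hR] at key
      exact key

theorem HasDqBound.mul {R : ℝ} (hR : 0 < R) {W : Set K} {F G : K → K} {b c : ℝ} (hb : 0 ≤ b)
    (hF : HasDqBound R W F b) (hG : HasDqBound R W G c) :
    HasDqBound R W (fun t => F t * G t) (b * c) := fun _ hX hW =>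
  norm_dq_mul_le hR hb hX (fun Y hY hne => hF Y hne fun u hu => hW u (hY hu))
    (fun Y hY hne => hG Y hne fun u hu => hW u (hY hu))

theorem HasDqBound.pow {R : ℝ} (hR : 0 < R) {W : Set K} {F : K → K} {b : ℝ} (hb : 0 ≤ b)
    (hF : HasDqBound R W F b) (m : ℕ) : HasDqBound R W (fun t => F t ^ m) (b ^ m) := by
  induction m with
  | zero => simpa using hasDqBound_const R W (1 : K)
  | succ m ih =>
    simp only [pow_succ]
    exact ih.mul hR (by positivity) hF

/-- If two points are more than `R` apart, the recursion expresses the divided difference through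
lower ones with a division costing less than `1 / R`, which is what the weight allows. -/
theorem HasDqBound.of_local {R : ℝ} (hR : 0 < R) {W : Set K} {F : K → K} {b : ℝ}
    (h : ∀ c ∈ W, HasDqBound R (W ∩ Metric.closedBall c R) F b) : HasDqBound R W F b := by
  classical
  intro X hX hW
  induction' hn : X.card using Nat.strong_induction_on with n ih generalizing X
  obtain ⟨u, hu⟩ := hX
  by_cases hl : ∀ v ∈ X, ‖v - u‖ ≤ R
  · rw [← hn]
    exact h u (hW u hu) X ⟨u, hu⟩ fun v hv => ⟨hW v hv, by
      rw [Metric.mem_closedBall, dist_eq_norm]; exact hl v hv⟩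
  push Not at hl
  obtain ⟨v, hv, hvu⟩ := hl
  have hne : v ≠ u := fun e => by
    rw [e, sub_self, norm_zero] at hvu
    exact absurd hvu hR.le.not_gt
  have key := dq_erase_sub_erase F hv hu hne
  have hcu := Finset.card_erase_of_mem hu
  have hcv := Finset.card_erase_of_mem hv
  have hnu : (X.erase u).Nonempty := ⟨v, by simp [hne, hv]⟩
  have hnv : (X.erase v).Nonempty := ⟨u, by simp [hne.symm, hu]⟩
  have hp := hnu.card_pos
  have bu := ih (n - 1) (by omega) (X.erase u) hnu
    (fun w hw => hW w (Finset.mem_of_mem_erase hw)) (by omega)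
  have bv := ih (n - 1) (by omega) (X.erase v) hnv
    (fun w hw => hW w (Finset.mem_of_mem_erase hw)) (by omega)
  have e : n - 1 = n - 1 - 1 + 1 := by omega
  have h1 : ‖v - u‖ * ‖dq F X‖ * R ^ (n - 1 - 1) ≤ b := by
    rw [smul_eq_mul] at key
    rw [← norm_mul, key]
    refine (mul_le_mul_of_nonneg_right (norm_sub_le_max' _ _) (by positivity)).trans ?_
    rw [max_mul_of_nonneg _ _ (by positivity)]
    exact max_le bu bv
  refine le_trans ?_ h1
  rw [e, pow_succ, Nat.add_sub_cancel, mul_comm ‖v - u‖, mul_assoc, mul_comm _ R]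
  gcongr

/-- Only orders 0 and 1 contribute: values have norm at most `max ‖c - a‖ R`, and the slope 1 has
weight `R`. -/
theorem hasDqBound_linear {R : ℝ} (hR : 0 < R) (a c : K) :
    HasDqBound R (Metric.closedBall c R) (fun t => t - a) (max ‖c - a‖ R) := by
  intro X hX hW
  have e : (fun t : K => t - a) = newton (fun _ => a) 1 := by ext t; simp [newton]
  rcases Nat.lt_or_ge X.card 2 with h | h
  · obtain ⟨u, rfl⟩ := Finset.card_eq_one.1 (show X.card = 1 by have := hX.card_pos; omega)
    have := hW u (by simp)
    rw [Metric.mem_closedBall, dist_eq_norm] at this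
    simp only [dq_singleton, Finset.card_singleton, Nat.sub_self, pow_zero, mul_one]
    rw [← sub_add_sub_cancel u c a, max_comm]
    exact (IsUltrametricDist.norm_add_le_max _ _).trans (max_le_max this le_rfl)
  · rw [e]
    rcases h.eq_or_lt with h | h
    · rw [dq_newton_of_eq _ h.symm, ← h]
      simp
    · rw [dq_newton_of_lt _ (by omega)]
      simp [hR.le]

theorem exists_hasDqBound_eval {R : ℝ} (hR : 0 < R) (c : K) (p : Polynomial K) :
    ∃ b, 0 ≤ b ∧ HasDqBound R (Metric.closedBall c R) (fun t => p.eval t) b := by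
  induction p using Polynomial.induction_on' with
  | add p q hp hq =>
    obtain ⟨b, hb, hb'⟩ := hp
    obtain ⟨d, hd, hd'⟩ := hq
    refine ⟨max b d, hb.trans (le_max_left _ _), ?_⟩
    simp only [Polynomial.eval_add]
    exact (hb'.mono (le_max_left _ _)).add hR.le (hd'.mono (le_max_right _ _))
  | monomial n a =>
    refine ⟨‖a‖ * (max ‖c - 0‖ R) ^ n, by positivity, ?_⟩
    have := (hasDqBound_const R (Metric.closedBall c R) a).mul hR (norm_nonneg _)
      ((hasDqBound_linear hR 0 c).pow hR (by positivity) n)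
    simpa using this

/-- Write `1 - F ^ (m+1) = (1 - F) + F (1 - F ^ m)`; ultrametrically the bound does not grow with
`m`. -/
theorem HasDqBound.one_sub_pow {R : ℝ} (hR : 0 < R) {W : Set K} {F : K → K} {b : ℝ}
    (hF : HasDqBound R W (fun t => 1 - F t) b) (hF1 : HasDqBound R W F 1) (m : ℕ) (hb : 0 ≤ b) :
    HasDqBound R W (fun t => 1 - F t ^ m) b := by
  induction m with
  | zero => simpa using (hasDqBound_const R W (0 : K)).mono (by simpa using hb)
  | succ m ih =>
    refine (hF.add hR.le ((hF1.mul hR zero_le_one ih).mono (one_mul b).le)).congr fun t _ => ?_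
    ring

theorem HasDqBound.one_of_one_sub {R : ℝ} (hR : 0 < R) {W : Set K} {F : K → K} {b : ℝ}
    (hb : b ≤ 1) (hF : HasDqBound R W (fun t => F t - 1) b) : HasDqBound R W F 1 :=
  ((hF.mono hb).add hR.le ((hasDqBound_const R W (1 : K)).mono (by simp))).congr fun t _ => by ring

/-- Polynomials which are close to `1` on one ball and close to `0` on finitely many others. -/
theorem exists_polynomial_ball {R : ℝ} (hR : 0 < R) (a₀ : K) (A : Finset K)
    (hA : ∀ a ∈ A, R < ‖a - a₀‖) {ε : ℝ} (hε : 0 < ε) (hε1 : ε ≤ 1) :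
    ∃ p : Polynomial K, HasDqBound R (Metric.closedBall a₀ R) (fun t => p.eval t - 1) ε ∧
      ∀ a ∈ A, HasDqBound R (Metric.closedBall a R) (fun t => p.eval t) ε := by
  classical
  -- The centre farthest from `a₀` is added last, so that the new factor has bound 1 on the balls
  -- already treated.
  induction A using Finset.induction_on_max_value (fun a => ‖a - a₀‖) with
  | empty =>
    refine ⟨1, ?_, by simp⟩
    simpa using (hasDqBound_const R (Metric.closedBall a₀ R) (0 : K)).mono (by simpa using hε.le)
  | insert b A hbA hmax ih =>
    simp only [Finset.mem_insert, forall_eq_or_imp] at hA ⊢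
    obtain ⟨p, hp, hpA⟩ := ih hA.2
    obtain ⟨C, hC, hpC⟩ := exists_hasDqBound_eval hR b p
    set d := ‖b - a₀‖ with hd
    have hd0 : 0 < d := hR.trans hA.1
    have hba : b - a₀ ≠ 0 := norm_pos_iff.1 hd0
    set q := R / d with hq
    have hq0 : 0 ≤ q := by positivity
    have hq1 : q < 1 := (div_lt_one hd0).2 hA.1
    -- `k` makes `w ^ k` small near `a₀`; `m` then makes the new factor small enough near `b` to
    -- beat the bound `C` for the old polynomial there.
    obtain ⟨k, hk⟩ := exists_pow_lt_of_lt_one hε hq1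
    obtain ⟨m, hm⟩ := exists_pow_lt_of_lt_one (show 0 < ε / (C + 1) by positivity) hq1
    set w : K → K := fun t => (t - a₀) * (b - a₀)⁻¹ with hw
    have hwb : ∀ a, HasDqBound R (Metric.closedBall a R) w (max ‖a - a₀‖ R * d⁻¹) := fun a => by
      have := (hasDqBound_linear hR a₀ a).mul hR (by positivity)
        (hasDqBound_const R (Metric.closedBall a R) (b - a₀)⁻¹)
      rwa [norm_inv, ← hd] at this
    have hw1 : ∀ a, ‖a - a₀‖ ≤ d → HasDqBound R (Metric.closedBall a R) w 1 := fun a ha =>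
      (hwb a).mono (by
        rw [← div_eq_mul_inv]
        exact div_le_one_of_le₀ (max_le ha hA.1.le) hd0.le)
    -- `Q = (1 - w ^ k) ^ m` with `w = (t - a₀)/(b - a₀)`. Near `a₀`, `w` has bound `q < 1`, so `Q`
    -- is close to 1. Near `b`, `1 - w` has bound `q`, hence so has `1 - w ^ k`, and `Q` has bound
    -- `q ^ m`. Near the other centres `Q` has bound 1.
    let Q : Polynomial K :=
      (1 - ((Polynomial.X - Polynomial.C a₀) * Polynomial.C (b - a₀)⁻¹) ^ k) ^ m
    have hQ : ∀ t, Q.eval t = (1 - w t ^ k) ^ m := fun t => by simp [Q, hw]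
    have hone : ∀ W : Set K, HasDqBound R W (fun _ => (1 : K)) 1 := fun W =>
      (hasDqBound_const R W (1 : K)).mono (by simp)
    refine ⟨p * Q, ?_, ?_, fun a ha => ?_⟩
    · have h1 : HasDqBound R (Metric.closedBall a₀ R) (fun t => w t ^ k) ε := by
        refine ((hwb a₀).pow hR (by positivity) k).mono (le_trans (le_of_eq ?_) hk.le)
        rw [sub_self, norm_zero, max_eq_right hR.le, hq, div_eq_mul_inv]
      have h2 : HasDqBound R (Metric.closedBall a₀ R) (fun t => 1 - (1 - w t ^ k) ^ m) ε :=
        HasDqBound.one_sub_pow hR (h1.congr fun t _ => by ring)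
          ((hone _).sub hR.le (h1.mono hε1)) m hε.le
      refine (hp.sub hR.le ((((hp.one_of_one_sub hR hε1)).mul hR zero_le_one h2).mono
        (one_mul ε).le)).congr fun t _ => ?_
      rw [Polynomial.eval_mul, hQ]
      ring
    · have h1 : HasDqBound R (Metric.closedBall b R) (fun t => 1 - w t) q := by
        refine ((hasDqBound_linear hR b b).mul hR (by positivity)
          (hasDqBound_const R _ (a₀ - b)⁻¹)).mono (le_of_eq ?_) |>.congr fun t _ => ?_
        · rw [sub_self, norm_zero, max_eq_right hR.le, norm_inv, norm_sub_rev, hq, div_eq_mul_inv]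
        · have : a₀ - b ≠ 0 := by rwa [← neg_sub, neg_ne_zero]
          simp only [hw]
          field_simp
          ring
      have h2 := (h1.one_sub_pow hR (hw1 b le_rfl) k hq0).pow hR hq0 m
      refine (hpC.mul hR hC h2).mono ?_ |>.congr fun t _ => by rw [Polynomial.eval_mul, hQ]
      rw [lt_div_iff₀ (by positivity)] at hm
      nlinarith [pow_nonneg hq0 m]
    · have h1 := hw1 a (hmax a ha)
      have h2 := ((hone _).sub hR.le ((h1.pow hR zero_le_one k).mono (one_pow k).le)).pow hR
        zero_le_one m
      exact ((hpA a ha).mul hR hε.le h2).mono (by simp) |>.congr fun t _ => by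
        rw [Polynomial.eval_mul, hQ]

open Classical in
/-- The function `t ^ n` on the ball of radius `R` around `c`, extended by zero. -/
def ballPow (R : ℝ) (c : K) (n : ℕ) (t : K) : K := if ‖t - c‖ ≤ R then t ^ n else 0

/-- The union of the balls of radius `R` around points of `A`. -/
def ballUnion (R : ℝ) (A : Finset K) : Set K := {t | ∃ a ∈ A, ‖t - a‖ ≤ R}

theorem exists_hasDqBound_ballPow {R : ℝ} (hR : 0 < R) {A : Finset K} {c : K} (n : ℕ) :
    ∃ b, HasDqBound R (ballUnion R A) (ballPow R c n) b := by
  obtain ⟨b, hb, hb'⟩ := exists_hasDqBound_eval hR c (Polynomial.X ^ n)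
  refine ⟨b, HasDqBound.of_local hR fun a _ X hX hW => ?_⟩
  by_cases hac : ‖a - c‖ ≤ R
  · have h1 : ∀ u ∈ X, ‖u - c‖ ≤ R := fun u hu => by
      have := (hW u hu).2
      rw [closedBall_eq_of_norm_sub_le hac, Metric.mem_closedBall, dist_eq_norm] at this
      exact this
    rw [dq_congr (G := fun t => (Polynomial.X ^ n : Polynomial K).eval t)
      fun t ht => by simp [ballPow, h1 t ht]]
    exact hb' X hX fun u hu => by
      rw [Metric.mem_closedBall, dist_eq_norm]; exact h1 u hu
  · have h1 : ∀ u ∈ X, ¬ ‖u - c‖ ≤ R := fun u hu h => hac (by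
      have := (hW u hu).2
      rw [Metric.mem_closedBall, dist_comm, dist_eq_norm] at this
      rw [← sub_add_sub_cancel a u c]
      exact (IsUltrametricDist.norm_add_le_max _ _).trans (max_le this h))
    rw [dq_congr (G := fun _ => (0 : K)) fun t ht => by simp [ballPow, h1 t ht]]
    exact ((hasDqBound_const R Set.univ (0 : K)) X hX fun _ _ => Set.mem_univ _).trans
      (by simpa using hb)

/-- Multiply `t ^ n` by a polynomial close to 1 on the ball around `c` and close to 0 on the others.
Separation makes the balls disjoint, so estimates on each of them suffice. -/
theorem exists_polynomial_ballPow {R : ℝ} (hR : 0 < R) {A : Finset K}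
    (hA : ∀ a ∈ A, ∀ b ∈ A, a ≠ b → R < ‖a - b‖) {c : K} (hc : c ∈ A) (n : ℕ) {ε : ℝ}
    (hε : 0 < ε) : ∃ q : Polynomial K,
      HasDqBound R (ballUnion R A) (fun t => ballPow R c n t - q.eval t) ε := by
  classical
  have hb : ∀ a : K, ∃ b, 0 ≤ b ∧
      HasDqBound R (Metric.closedBall a R) (fun t => t ^ n) b := fun a => by
    simpa using exists_hasDqBound_eval hR a (Polynomial.X ^ n)
  choose b hb0 hb using hb
  obtain ⟨C, hC⟩ : ∃ C, ∀ a ∈ A, b a ≤ C := by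
    obtain ⟨C, hC⟩ := (A.finite_toSet.image b).bddAbove
    exact ⟨C, fun a ha => hC ⟨a, ha, rfl⟩⟩
  have hC0 : 0 ≤ C := (hb0 c).trans (hC c hc)
  -- The accuracy for the ball polynomial absorbs the common bound `C` of `t ^ n` on all the balls.
  have hδ : 0 < min 1 (ε / (C + 1)) := lt_min one_pos (by positivity)
  have hδC : min 1 (ε / (C + 1)) * C ≤ ε := by
    have h1 : min 1 (ε / (C + 1)) * (C + 1) ≤ ε := by
      rw [← le_div_iff₀ (by positivity)]
      exact min_le_right _ _
    nlinarith
  obtain ⟨p, hp, hpA⟩ := exists_polynomial_ball hR c (A.erase c)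
    (fun a ha => hA a (Finset.mem_of_mem_erase ha) c hc (Finset.ne_of_mem_erase ha)) hδ
    (min_le_left _ _)
  refine ⟨p * Polynomial.X ^ n, HasDqBound.of_local hR fun t₀ ht₀ X hX hW => ?_⟩
  obtain ⟨a, ha, hta⟩ := ht₀
  have hXa : ∀ u ∈ X, u ∈ Metric.closedBall a R := fun u hu => by
    rw [← closedBall_eq_of_norm_sub_le hta]
    exact (hW u hu).2
  rcases eq_or_ne a c with rfl | hac
  · have h : HasDqBound R (Metric.closedBall a R) (fun t => (p.eval t - 1) * t ^ n) ε :=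
      (hp.mul hR hδ.le ((hb a).mono (hC a ha))).mono hδC
    suffices h' : HasDqBound R (Metric.closedBall a R)
        (fun t => ballPow R a n t - (p * Polynomial.X ^ n).eval t) ε from h' X hX hXa
    refine h.neg.congr fun t ht => ?_
    rw [Metric.mem_closedBall, dist_eq_norm] at ht
    simp only [ballPow, ht, if_true, Polynomial.eval_mul, Polynomial.eval_pow, Polynomial.eval_X]
    ring
  · have h : HasDqBound R (Metric.closedBall a R) (fun t => p.eval t * t ^ n) ε :=
      ((hpA a (Finset.mem_erase.2 ⟨hac, ha⟩)).mul hR hδ.le ((hb a).mono (hC a ha))).mono hδC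
    suffices h' : HasDqBound R (Metric.closedBall a R)
        (fun t => ballPow R c n t - (p * Polynomial.X ^ n).eval t) ε from h' X hX hXa
    refine h.neg.congr fun t ht => ?_
    rw [Metric.mem_closedBall, dist_comm, dist_eq_norm] at ht
    have : ¬ ‖t - c‖ ≤ R := fun htc => by
      refine absurd (hA a ha c hc hac) (not_lt.2 ?_)
      rw [← sub_add_sub_cancel a t c]
      exact (IsUltrametricDist.norm_add_le_max _ _).trans (max_le ht htc)
    simp [ballPow, this]

end OneVariableBounds

/-! ### From locally polynomial functions to polynomials on finitely many polydiscs. -/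

section PolynomialApproximation

variable {K : Type*} [NontriviallyNormedField K] [IsUltrametricDist K]
variable {ι : Type*} [Fintype ι] [DecidableEq ι]

/-- Change one factor at a time; the ultrametric inequality replaces the sum of the errors by their
maximum. -/
theorem norm_prod_sub_prod_le {a b : ι → K} {C η : ℝ} (hC : 1 ≤ C) (hη0 : 0 ≤ η) (hη : η ≤ 1)
    (ha : ∀ i, ‖a i‖ ≤ C) (hab : ∀ i, ‖a i - b i‖ ≤ η) (s : Finset ι) :
    ‖∏ i ∈ s, a i - ∏ i ∈ s, b i‖ ≤ η * C ^ s.card := by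
  have hb : ∀ i, ‖b i‖ ≤ C := fun i => by
    rw [← sub_sub_cancel (a i) (b i)]
    exact (norm_sub_le_max' _ _).trans (max_le (ha i) ((hab i).trans (hη.trans hC)))
  induction s using Finset.induction_on with
  | empty => simpa using hη0
  | insert i s hi ih =>
    have hC0 : 0 ≤ C := zero_le_one.trans hC
    rw [Finset.prod_insert hi, Finset.prod_insert hi, Finset.card_insert_of_notMem hi]
    have e : a i * ∏ j ∈ s, a j - b i * ∏ j ∈ s, b j =
        a i * (∏ j ∈ s, a j - ∏ j ∈ s, b j) + (a i - b i) * ∏ j ∈ s, b j := by ring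
    rw [e]
    refine (IsUltrametricDist.norm_add_le_max _ _).trans (max_le ?_ ?_)
    · rw [norm_mul, pow_succ]
      calc ‖a i‖ * _ ≤ C * (η * C ^ s.card) := mul_le_mul (ha i) ih (norm_nonneg _) hC0
        _ = _ := by ring
    · rw [norm_mul, norm_prod]
      have h1 : ∏ j ∈ s, ‖b j‖ ≤ C ^ s.card := by
        rw [← Finset.prod_const]
        exact Finset.prod_le_prod (fun _ _ => norm_nonneg _) fun j _ => hb j
      calc ‖a i - b i‖ * _ ≤ η * C ^ s.card :=
            mul_le_mul (hab i) h1 (Finset.prod_nonneg fun _ _ => norm_nonneg _) hη0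
        _ ≤ _ := mul_le_mul_of_nonneg_left (pow_le_pow_right₀ hC (Nat.le_succ _)) hη0

variable {E : Type*} [AddCommGroup E] [Module K E] [TopologicalSpace E] [ContinuousSMul K E]

theorem HasDqBound.norm_dq_le {R : ℝ} (hR : 0 < R) (hR1 : R ≤ 1) {W : Set K} {F : K → K} {b : ℝ}
    (h : HasDqBound R W F b) {X : Finset K} (hX : X.Nonempty) (hW : ∀ u ∈ X, u ∈ W) {k : ℕ}
    (hk : X.card ≤ k + 1) : ‖dq F X‖ ≤ b / R ^ k := by
  rw [le_div_iff₀ (by positivity)]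
  refine le_trans ?_ (h X hX hW)
  exact mul_le_mul_of_nonneg_left (pow_le_pow_of_le_one hR.le hR1 (by omega)) (norm_nonneg _)

open Classical in
/-- A polynomial on one polydisc, extended by zero, can be approximated by polynomials on a finite
union of polydiscs. -/
theorem exists_polynomialFun_ball {M : AddSubgroup E} (hM : (M : Set E) ∈ 𝓝 0)
    {R : ℝ} (hR : 0 < R) (hR1 : R ≤ 1) {A : ι → Finset K}
    (hA : ∀ i, ∀ a ∈ A i, ∀ b ∈ A i, a ≠ b → R < ‖a - b‖) (k : ℕ) {c : ι → K} (hc : ∀ i, c i ∈ A i)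
    {p : (ι → K) → E} (hp : p ∈ polynomialFun K ι E) :
    ∃ q ∈ polynomialFun K ι E, ∀ X : ι → Finset K, (∀ i, (X i).Nonempty) →
      (∀ i, (X i).card ≤ k + 1) → (∀ i, ∀ u ∈ X i, u ∈ ballUnion R (A i)) →
        gdq ((fun x => if ∀ i, ‖x i - c i‖ ≤ R then p x else 0) - q) X ∈ M := by
  induction hp using AddSubgroup.closure_induction with
  | mem p hp =>
    obtain ⟨β, e, rfl⟩ := hp
    obtain ⟨ε, hε, hεM⟩ : ∃ ε > 0, ∀ c : K, ‖c‖ ≤ ε → c • e ∈ M := by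
      have h1 : Filter.Tendsto (fun c : K => c • e) (𝓝 0) (𝓝 0) := by
        have : Continuous fun c : K => c • e := by fun_prop
        simpa using this.tendsto 0
      obtain ⟨ε, hε, h⟩ := Metric.mem_nhds_iff.1 (h1 hM)
      refine ⟨ε / 2, by positivity, fun c hc => h ?_⟩
      rw [Metric.mem_ball, dist_zero_right]
      linarith
    choose b hb using fun i => exists_hasDqBound_ballPow hR (A := A i) (c := c i) (β i)
    -- A common bound, at least 1, for the one-variable divided differences of order at most `k` of
    -- all the factors.
    set C := 1 + ∑ i, |b i| / R ^ k with hCdef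
    have hC1 : 1 ≤ C := le_add_of_nonneg_right (Finset.sum_nonneg fun i _ => by positivity)
    have hCb : ∀ i, b i / R ^ k ≤ C := fun i => by
      have h1 : |b i| / R ^ k ≤ ∑ i, |b i| / R ^ k :=
        Finset.single_le_sum (f := fun i => |b i| / R ^ k) (fun i _ => by positivity)
          (Finset.mem_univ i)
      have h2 : b i / R ^ k ≤ |b i| / R ^ k := by gcongr; exact le_abs_self _
      linarith
    have hC0 : 0 < C := zero_lt_one.trans_le hC1
    set η := min 1 (ε / C ^ (Finset.univ : Finset ι).card) with hη
    have hη0 : 0 < η := lt_min one_pos (by positivity)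
    -- The factor `R ^ k` turns the weighted bound into the plain bound `η` on divided differences
    -- of order at most `k`, and `η` is small enough for the product estimate to give `ε`.
    choose q hq using fun i => exists_polynomial_ballPow hR (hA i) (hc i) (β i)
      (show 0 < η * R ^ k by positivity)
    refine ⟨_, prod_eval_smul_mem_polynomialFun q e, fun X hX hk hW => ?_⟩
    have e1 : (fun x : ι → K => if ∀ i, ‖x i - c i‖ ≤ R then (∏ i, x i ^ β i) • e else 0) =
        fun x => (∏ i, ballPow R (c i) (β i) (x i)) • e := by
      ext x
      split_ifs with h
      · simp [ballPow, h]
      · push Not at h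
        obtain ⟨i, hi⟩ := h
        rw [Finset.prod_eq_zero (Finset.mem_univ i), zero_smul]
        simp [ballPow, hi]
    rw [e1, gdq_sub, gdq_prod_smul, gdq_prod_smul (fun i t => (q i).eval t), ← sub_smul]
    refine hεM _ ((norm_prod_sub_prod_le hC1 hη0.le (min_le_left _ _) (fun i => ?_)
      (fun i => ?_) Finset.univ).trans ?_)
    · exact ((hb i).norm_dq_le hR hR1 (hX i) (hW i) (hk i)).trans (hCb i)
    · rw [← dq_sub]
      refine ((hq i).norm_dq_le hR hR1 (hX i) (hW i) (hk i)).trans (le_of_eq ?_)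
      rw [mul_div_assoc, div_self (by positivity), mul_one]
    · rw [← le_div_iff₀ (by positivity)]
      exact min_le_right _ _
  | zero =>
    refine ⟨0, AddSubgroup.zero_mem _, fun X _ _ _ => ?_⟩
    have e1 : (fun x : ι → K => if ∀ i, ‖x i - c i‖ ≤ R then (0 : (ι → K) → E) x else 0) = 0 := by
      ext x
      simp
    rw [e1, sub_self, gdq_zero]
    exact M.zero_mem
  | add p p' _ _ hp hp' =>
    obtain ⟨q, hq, h⟩ := hp
    obtain ⟨q', hq', h'⟩ := hp'
    refine ⟨q + q', AddSubgroup.add_mem _ hq hq', fun X hX hk hW => ?_⟩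
    have := M.add_mem (h X hX hk hW) (h' X hX hk hW)
    rw [← gdq_add] at this
    convert this using 2
    ext x
    simp only [Pi.sub_apply, Pi.add_apply]
    split_ifs <;> abel
  | neg p _ hp =>
    obtain ⟨q, hq, h⟩ := hp
    refine ⟨-q, AddSubgroup.neg_mem _ hq, fun X hX hk hW => ?_⟩
    have := M.neg_mem (h X hX hk hW)
    rw [← gdq_neg] at this
    convert this using 2
    ext x
    simp only [Pi.sub_apply, Pi.neg_apply]
    split_ifs <;> abel

/-- Locally polynomial functions can be approximated by polynomials on a finite union of
polydiscs. -/
theorem IsLocallyPolynomial.exists_polynomialFun {M : AddSubgroup E} (hM : (M : Set E) ∈ 𝓝 0)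
    {ρ : K} (hρ : ρ ≠ 0) (hρ1 : ‖ρ‖ ≤ 1) {A : ι → Finset K}
    (hA : ∀ i, ∀ a ∈ A i, ∀ b ∈ A i, a ≠ b → ‖ρ‖ < ‖a - b‖) (k : ℕ) {g : (ι → K) → E}
    (hg : IsLocallyPolynomial ρ g) :
    ∃ q ∈ polynomialFun K ι E, ∀ X : ι → Finset K, (∀ i, (X i).Nonempty) →
      (∀ i, (X i).card ≤ k + 1) → (∀ i, ∀ u ∈ X i, u ∈ ballUnion ‖ρ‖ (A i)) →
        gdq (g - q) X ∈ M := by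
  classical
  choose p hp hgp using hg
  have := fun c : ι → K => fun hc : ∀ i, c i ∈ A i =>
    exists_polynomialFun_ball hM (norm_pos_iff.2 hρ) hρ1 hA k hc (hp c)
  choose! q hq h using this
  refine ⟨∑ c ∈ Fintype.piFinset A, q c, AddSubgroup.sum_mem _ fun c hc =>
    hq c (Fintype.mem_piFinset.1 hc), fun X hX hk hW => ?_⟩
  -- The polydiscs centred at points of `∏ A i` are disjoint, so on their union `g` is the sum of
  -- its polynomial pieces extended by zero.
  have e : gdq (g - ∑ c ∈ Fintype.piFinset A, q c) X = ∑ c ∈ Fintype.piFinset A,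
      gdq ((fun x => if ∀ i, ‖x i - c i‖ ≤ ‖ρ‖ then p c x else 0) - q c) X := by
    simp only [gdq_sub, Finset.sum_sub_distrib, ← gdq_sum]
    congr 1
    refine gdq_congr fun x hx => ?_
    choose a ha hxa using fun i => hW i (x i) (hx i)
    rw [Finset.sum_apply, Finset.sum_eq_single a]
    · rw [if_pos hxa]
      exact hgp a x hxa
    · intro c hc hca
      refine if_neg fun hxc => hca (funext fun i => ?_)
      by_contra hne
      refine absurd (hA i _ (Fintype.mem_piFinset.1 hc i) _ (ha i) hne) (not_lt.2 ?_)
      refine norm_sub_le_of_norm_sub_le (t := x i) ?_ ?_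
      · rw [norm_sub_rev]; exact hxc i
      · rw [norm_sub_rev]; exact hxa i
    · intro hn
      exact absurd (Fintype.mem_piFinset.2 ha) hn
  rw [e]
  exact AddSubgroup.sum_mem _ fun c hc => h c (Fintype.mem_piFinset.1 hc) X hX hk hW

end PolynomialApproximation

/-! ### Difference quotients of polynomials extend continuously. -/

section PolynomialsAreSmooth

variable {K : Type*} [Field K] [TopologicalSpace K] [IsTopologicalRing K]

/-- The complete homogeneous symmetric polynomial: divided differences of `t ^ m`. -/
def homogPow (m : ℕ) : (n : ℕ) → (Fin (n + 1) → K) → K :=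
  m.rec (fun n _ => if n = 0 then 1 else 0)
    fun _ H n x => x 0 * H n x + match n, x with
      | 0, _ => 0
      | n + 1, x => H n (fun k => x k.succ)

theorem continuous_homogPow (m n : ℕ) : Continuous (homogPow (K := K) m n) := by
  induction m generalizing n with
  | zero => exact continuous_const
  | succ m ih =>
    cases n with
    | zero => exact ((continuous_apply 0).mul (ih 0)).add continuous_const
    | succ n =>
      exact ((continuous_apply 0).mul (ih _)).add
        ((ih n).comp (continuous_pi fun k => continuous_apply _))

/-- Leibniz' rule for `t · t ^ m` at the node `x 0` reproduces the recursion defining `homogPow`,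
which is continuous also where entries coincide. -/
theorem dq_pow [DecidableEq K] (m n : ℕ) {x : Fin (n + 1) → K} (hx : Function.Injective x) :
    dq (fun t : K => t ^ m) (Finset.univ.image x) = homogPow m n x := by
  induction m generalizing n with
  | zero =>
    have hc : (Finset.univ.image x).card = n + 1 := by
      rw [Finset.card_image_of_injective _ hx, Finset.card_univ, Fintype.card_fin]
    have e : (fun t : K => t ^ 0) = newton (fun _ => 0) 0 := by ext; simp [newton]
    rw [e]
    rcases Nat.eq_zero_or_pos n with rfl | hn
    · rw [dq_newton_of_eq _ hc]
      rfl
    · rw [dq_newton_of_lt _ (by omega)]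
      exact (if_neg hn.ne').symm
  | succ m ih =>
    have h0 : x 0 ∈ Finset.univ.image x := Finset.mem_image_of_mem _ (Finset.mem_univ _)
    have h := dq_linear_mul (fun t => t ^ m) 0 h0
    have e1 : (fun t : K => t ^ (m + 1)) = fun t => (t - 0) * t ^ m := by
      ext t
      rw [pow_succ, sub_zero, mul_comm]
    rw [e1]
    have e2 : @Finset.erase K (fun a b => Classical.propDecidable (a = b))
        (Finset.univ.image x) (x 0) = (Finset.univ.image x).erase (x 0) := by congr!
    rw [h, e2, ih n hx, sub_zero, add_comm]
    cases n with
    | zero =>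
      have : (Finset.univ.image x).erase (x 0) = ∅ := by
        ext t
        simp only [Finset.mem_erase, Finset.mem_image, Finset.mem_univ, true_and,
          Finset.notMem_empty, iff_false, not_and, not_exists]
        rintro ht i rfl
        exact ht (congrArg x (Fin.ext (by omega)))
      rw [this, dq_empty]
      rfl
    | succ n =>
      have : (Finset.univ.image x).erase (x 0) = Finset.univ.image fun k : Fin (n + 1) =>
          x k.succ := by
        ext t
        simp only [Finset.mem_erase, Finset.mem_image, Finset.mem_univ, true_and]
        constructor
        · rintro ⟨ht, i, rfl⟩
          exact ⟨i.pred fun h => ht (by rw [h]), by simp⟩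
        · rintro ⟨k, rfl⟩
          exact ⟨fun h => Fin.succ_ne_zero k (hx h), _, rfl⟩
      rw [this, ih n (x := fun k => x k.succ) (hx.comp (Fin.succ_injective _))]
      rfl

variable {ι : Type*} [Fintype ι] [DecidableEq ι]
variable {E : Type*} [AddCommGroup E] [Module K E] [TopologicalSpace E]
  [IsTopologicalAddGroup E] [ContinuousSMul K E]

/-- Divided differences of a monomial are products of one-variable ones, each given by the
continuous `homogPow`. -/
theorem IsPol.exists_extendsDiffQuot {U V : Set (ι → K)} (hV : V ⊆ U) {p : U → E} (hp : IsPol p)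
    (β : ι → ℕ) : ∃ g : C(diffDomain V β, E), ExtendsDiffQuot (restr hV p) β g := by
  classical
  obtain ⟨a, ha⟩ := hp
  refine ⟨⟨fun x => a.sum fun γ e => (∏ i, homogPow (γ i) (β i) (x.1 i)) • e, ?_⟩, fun x => ?_⟩
  · refine continuous_finsetSum _ fun γ _ => ?_
    refine Continuous.smul (continuous_finsetProd _ fun i _ => ?_) continuous_const
    exact (continuous_homogPow _ _).comp ((continuous_apply i).comp continuous_subtype_val)
  · rw [diffQuot_restr hV]
    have e : gdq (extZero p) (fun i => Finset.univ.image (x.1 i)) =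
        gdq (∑ γ ∈ a.support, fun y : ι → K => (∏ i, y i ^ γ i) • a γ)
          fun i => Finset.univ.image (x.1 i) := by
      refine gdq_congr fun y hy => ?_
      have hyU : y ∈ U := by
        simp only [Finset.mem_image, Finset.mem_univ, true_and] at hy
        choose j hj using hy
        have := hV (x.2.1 j)
        simpa only [hj] using this
      rw [extZero_of_mem p hyU, ha, Finset.sum_apply]
      rfl
    have e' : (fun i => @Finset.image _ _ (fun a b => Classical.propDecidable (a = b)) (x.1 i)
        Finset.univ) = fun i => Finset.univ.image (x.1 i) := by congr!
    rw [e', e, gdq_sum]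
    refine Finset.sum_congr rfl fun γ _ => ?_
    rw [gdq_prod_smul (fun i t => t ^ γ i)]
    simp only [dq_pow _ _ (x.2.2 _)]

end PolynomialsAreSmooth

/-- Uniform continuity at a compact set, with only one of the two points required to lie in it.
Grids near `L` need not lie in a compact set, so this form is the one needed. -/
theorem exists_uniform_sub_mem {X : Type*} [PseudoMetricSpace X] {E : Type*} [AddCommGroup E]
    [TopologicalSpace E] [IsTopologicalAddGroup E] {M : AddSubgroup E} (hM : IsOpen (M : Set E))
    {g : X → E} (hg : Continuous g) {C : Set X} (hC : IsCompact C) :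
    ∃ R > (0 : ℝ), ∀ y ∈ C, ∀ x, dist x y ≤ R → g x - g y ∈ M := by
  refine hC.induction_on (p := fun C => ∃ R > (0 : ℝ), ∀ y ∈ C, ∀ x, dist x y ≤ R → g x - g y ∈ M)
    ⟨1, one_pos, by simp⟩ ?_ ?_ ?_
  · rintro s t hst ⟨R, hR, h⟩
    exact ⟨R, hR, fun y hy => h y (hst hy)⟩
  · rintro s t ⟨R, hR, h⟩ ⟨R', hR', h'⟩
    refine ⟨min R R', lt_min hR hR', ?_⟩
    rintro y (hy | hy) x hx
    · exact h y hy x (hx.trans (min_le_left _ _))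
    · exact h' y hy x (hx.trans (min_le_right _ _))
  · intro y _
    have hopen : IsOpen {x | g x - g y ∈ M} := hM.preimage (hg.sub continuous_const)
    obtain ⟨R, hR, h⟩ := Metric.isOpen_iff.1 hopen y (by simp [M.zero_mem])
    refine ⟨Metric.ball y (R / 2), mem_nhdsWithin_of_mem_nhds (Metric.ball_mem_nhds _ (by positivity)),
      R / 2, by positivity, fun y' hy' x hx => ?_⟩
    rw [Metric.mem_ball] at hy'
    have h1 : g x - g y ∈ M := h (by
      rw [Metric.mem_ball]
      linarith [dist_triangle x y' y])
    have h2 : g y' - g y ∈ M := h (by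
      rw [Metric.mem_ball]
      linarith)
    have := M.sub_mem h1 h2
    rwa [sub_sub_sub_cancel_right] at this

/-! ### Uniform estimates near compact sets, and gluing. -/

section Compactness

variable {K : Type*} [NontriviallyNormedField K] [IsUltrametricDist K]
variable {ι : Type*} [Fintype ι] [DecidableEq ι]

/-- The polydisc of radius `R` around `a`. -/
def polydisc (a : ι → K) (R : ℝ) : Set (ι → K) := {x | ∀ i, ‖x i - a i‖ ≤ R}

theorem polydisc_eq_closedBall (a : ι → K) {R : ℝ} (hR : 0 ≤ R) :
    polydisc a R = Metric.closedBall a R := by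
  ext x
  simp [polydisc, dist_eq_norm, pi_norm_le_iff_of_nonneg hR]

theorem isOpen_polydisc (a : ι → K) {R : ℝ} (hR : 0 < R) : IsOpen (polydisc a R) := by
  have : polydisc a R = Set.univ.pi fun i => Metric.closedBall (a i) R := by
    ext x
    simp [polydisc, dist_eq_norm]
  rw [this]
  exact isOpen_set_pi Set.finite_univ fun i _ => IsUltrametricDist.isOpen_closedBall _ hR.ne'

theorem norm_sub_le_trans {u v t : K} {R : ℝ} (h1 : ‖u - v‖ ≤ R) (h2 : ‖v - t‖ ≤ R) :
    ‖u - t‖ ≤ R :=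
  norm_sub_le_of_norm_sub_le h1 (by rwa [norm_sub_rev])

/-- If the trace of `U` on a polydisc lies in a cartesian neighbourhood, every smaller polydisc
centred in it stays inside by the ultrametric inequality, and its trace is again a product.
Compactness makes the radius uniform. -/
theorem exists_radius_isCartesian {U : Set (ι → K)} (hU : IsLocallyCartesian U) {L : Set (ι → K)}
    (hL : IsCompact L) (hLU : L ⊆ U) : ∃ R > (0 : ℝ), ∀ y ∈ L, ∀ s, 0 < s → s ≤ R →
      IsRelOpen (U ∩ polydisc y s) U ∧ IsCartesian (U ∩ polydisc y s) := by
  refine hL.induction_on (p := fun L => ∃ R > (0 : ℝ), ∀ y ∈ L, ∀ s, 0 < s → s ≤ R →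
      IsRelOpen (U ∩ polydisc y s) U ∧ IsCartesian (U ∩ polydisc y s))
    ⟨1, one_pos, by simp⟩ ?_ ?_ ?_
  · rintro s t hst ⟨R, hR, h⟩
    exact ⟨R, hR, fun y hy => h y (hst hy)⟩
  · rintro s t ⟨R, hR, h⟩ ⟨R', hR', h'⟩
    refine ⟨min R R', lt_min hR hR', ?_⟩
    rintro y (hy | hy) x hx0 hx
    · exact h y hy x hx0 (hx.trans (min_le_left _ _))
    · exact h' y hy x hx0 (hx.trans (min_le_right _ _))
  · intro x hx
    obtain ⟨V, ⟨hVU, hVo⟩, hxV, S, hS, rfl⟩ := hU x (hLU hx)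
    obtain ⟨O, hO, hOV⟩ := isOpen_induced_iff.1 hVo
    have hxO : x ∈ O := by
      have : (⟨x, hLU hx⟩ : U) ∈ Subtype.val ⁻¹' O := by rw [hOV]; exact hxV
      exact this
    obtain ⟨R, hR, hRO⟩ := Metric.nhds_basis_closedBall.mem_iff.1 (hO.mem_nhds hxO)
    rw [← polydisc_eq_closedBall x hR.le] at hRO
    refine ⟨polydisc x R, mem_nhdsWithin_of_mem_nhds ((isOpen_polydisc x hR).mem_nhds
      fun i => by simpa using hR.le), R, hR, fun y hy s hs hsR => ⟨⟨Set.inter_subset_left, ?_⟩, ?_⟩⟩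
    · have : {z : U | (z : ι → K) ∈ U ∩ polydisc y s} = Subtype.val ⁻¹' polydisc y s := by
        ext z
        simp
      rw [this]
      exact (isOpen_polydisc y hs).preimage continuous_subtype_val
    · refine ⟨fun i => Metric.closedBall (y i) s ∩ S i, fun i => (hS i).open_inter
        (IsUltrametricDist.isOpen_closedBall _ hs.ne'), ?_⟩
      ext z
      simp only [Set.mem_inter_iff, Set.mem_univ_pi, Metric.mem_closedBall, dist_eq_norm]
      constructor
      · rintro ⟨hzU, hz⟩ i
        refine ⟨hz i, ?_⟩
        have hzO : z ∈ O := hRO fun i => norm_sub_le_trans ((hz i).trans hsR) (hy i)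
        have : (⟨z, hzU⟩ : U) ∈ {x : U | (x : ι → K) ∈ Set.univ.pi S} := by rw [← hOV]; exact hzO
        exact this i (Set.mem_univ i)
      · intro h
        exact ⟨hVU fun i _ => (h i).2, fun i => (h i).1⟩

/-- An enumeration of a finite set with `n` elements. -/
def enumFinset (X : Finset K) (n : ℕ) (k : Fin n) : K :=
  if h : X.card = n then ((X.equivFinOfCardEq h).symm k : K) else 0

theorem enumFinset_mem {X : Finset K} {n : ℕ} (h : X.card = n) (k : Fin n) :
    enumFinset X n k ∈ X := by
  rw [enumFinset, dif_pos h]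
  exact ((X.equivFinOfCardEq h).symm k).2

theorem enumFinset_injective {X : Finset K} {n : ℕ} (h : X.card = n) :
    Function.Injective (enumFinset X n) := by
  intro k l hkl
  rw [enumFinset, enumFinset, dif_pos h, dif_pos h] at hkl
  exact (X.equivFinOfCardEq h).symm.injective (Subtype.ext hkl)

theorem image_enumFinset [DecidableEq K] {X : Finset K} {n : ℕ} (h : X.card = n) :
    Finset.univ.image (enumFinset X n) = X := by
  refine Finset.eq_of_subset_of_card_le (fun t ht => ?_) ?_
  · obtain ⟨k, -, rfl⟩ := Finset.mem_image.1 ht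
    exact enumFinset_mem h k
  · rw [Finset.card_image_of_injective _ (enumFinset_injective h), h]
    simp

variable {E : Type*} [AddCommGroup E] [Module K E] [TopologicalSpace E]
  [IsTopologicalAddGroup E]

/-- Divided differences vary little near a compact subset of a cartesian set. -/
theorem exists_radius_gdq_sub_mem {M : AddSubgroup E} (hM : IsOpen (M : Set E))
    {U : Set (ι → K)} (f : U → E) {S : ι → Set K} (hSU : Set.univ.pi S ⊆ U) {β : ι → ℕ}
    (hf : ∃ g : C(diffDomain (Set.univ.pi S) β, E), ExtendsDiffQuot (restr hSU f) β g)
    {C : ι → Set K} (hC : ∀ i, IsCompact (C i)) (hCS : ∀ i, C i ⊆ S i) :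
    ∃ R > (0 : ℝ), ∀ r ≤ R, ∀ X Y : ι → Finset K,
      (∀ i, (X i).card = β i + 1) → (∀ i, (Y i).card = β i + 1) →
      (∀ i, ∀ u ∈ X i, u ∈ S i ∧ ∃ t ∈ C i, ‖u - t‖ ≤ r) →
      (∀ i, ∀ u ∈ Y i, u ∈ S i ∧ ∃ t ∈ C i, ‖u - t‖ ≤ r) →
      (∀ i, X i = Y i ∨ ∀ u ∈ X i, ∀ v ∈ Y i, ‖u - v‖ ≤ r) →
        gdq (extZero f) X - gdq (extZero f) Y ∈ M := by
  classical
  obtain ⟨g, hg⟩ := hf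
  set D : Set ((i : ι) → Fin (β i + 1) → K) := Set.univ.pi fun i => Set.univ.pi fun _ => C i with hD
  have hDc : IsCompact D := isCompact_univ_pi fun i => isCompact_univ_pi fun _ => hC i
  have hDsub : D ⊆ diffDomain (Set.univ.pi S) β := fun x hx j i _ =>
    hCS i (hx i (Set.mem_univ i) (j i) (Set.mem_univ _))
  set D' : Set (diffDomain (Set.univ.pi S) β) := Subtype.val ⁻¹' D with hD'
  have hDc' : IsCompact D' := by
    rw [Subtype.isCompact_iff, hD', Subtype.image_preimage_coe, Set.inter_eq_right.2 hDsub]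
    exact hDc
  obtain ⟨R, hR, h⟩ := exists_uniform_sub_mem hM g.continuous hDc'
  refine ⟨R, hR, fun r hr X Y hX hY hXS hYS hXY => ?_⟩
  have main : ∀ Z : ι → Finset K, ∀ hZ : ∀ i, (Z i).card = β i + 1,
      (∀ i, ∀ u ∈ Z i, u ∈ S i ∧ ∃ t ∈ C i, ‖u - t‖ ≤ r) →
      ∃ x : diffDomain (Set.univ.pi S) β,
        (∀ i, x.1 i = enumFinset (Z i) (β i + 1)) ∧ gdq (extZero f) Z = g x := by
    intro Z hZ hZS
    let z : strictDiffDomain (Set.univ.pi S) β := ⟨fun i => enumFinset (Z i) (β i + 1),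
      fun j i _ => (hZS i _ (enumFinset_mem (hZ i) (j i))).1,
      fun i => enumFinset_injective (hZ i)⟩
    refine ⟨⟨z.1, z.2.1⟩, fun i => rfl, ?_⟩
    rw [hg z, diffQuot_restr hSU]
    congr 1
    ext1 i
    exact (image_enumFinset (hZ i)).symm
  obtain ⟨x, hx, hxg⟩ := main X hX hXS
  obtain ⟨y, hy, hyg⟩ := main Y hY hYS
  have hxt : ∀ i (k : Fin (β i + 1)), ∃ t ∈ C i, ‖x.1 i k - t‖ ≤ r := fun i k => by
    rw [hx i]
    exact (hXS i _ (enumFinset_mem (hX i) k)).2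
  choose t htC htx using hxt
  -- Both grids are compared with one point `z` of the compact set, chosen close to the enumeration
  -- of `X`. It is also close to that of `Y`, since in each direction the grids coincide or all
  -- their points are mutually close.
  let z : diffDomain (Set.univ.pi S) β := ⟨fun i k => t i k, hDsub fun i _ k _ => htC i k⟩
  have hz : z ∈ D' := fun i _ k _ => htC i k
  have hx' : g x - g z ∈ M := h z hz x (by
    rw [Subtype.dist_eq, dist_pi_le_iff hR.le]
    intro i
    rw [dist_pi_le_iff hR.le]
    intro k
    rw [dist_eq_norm]
    exact (htx i k).trans hr)
  have hy' : g y - g z ∈ M := h z hz y (by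
    rw [Subtype.dist_eq, dist_pi_le_iff hR.le]
    intro i
    rw [dist_pi_le_iff hR.le]
    intro k
    rw [dist_eq_norm]
    refine le_trans ?_ hr
    have h1 := htx i k
    rw [hx i] at h1
    rw [hy i]
    rcases hXY i with e | e
    · rw [← e]; exact h1
    · refine norm_sub_le_trans ?_ h1
      rw [norm_sub_rev]
      exact e _ (enumFinset_mem (hX i) k) _ (enumFinset_mem (hY i) k))
  rw [hxg, hyg, ← sub_sub_sub_cancel_right _ _ (g z)]
  exact M.sub_mem hx' hy'

theorem finite_blockSet {J : Type*} [DecidableEq J] (π : ι → J) (r : J → ℕ) :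
    (blockSet π r).Finite := by
  refine (Set.finite_Iic fun i => r (π i)).subset fun β hβ i => ?_
  exact (Finset.single_le_sum (f := β) (s := Finset.univ.filter fun k => π k = π i)
    (fun _ _ => Nat.zero_le _) (Finset.mem_filter.2 ⟨Finset.mem_univ i, rfl⟩)).trans (hβ (π i))

/-- `X` is a grid of order in `N`, contained in `U` and in the `R`-neighbourhood of `L`. -/
structure IsGridNear (U L : Set (ι → K)) (N : Set (ι → ℕ)) (R : ℝ) (X : ι → Finset K) : Prop where
  nonempty : ∀ i, (X i).Nonempty
  order_mem : gridOrder X ∈ N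
  subset : ∀ x : ι → K, (∀ i, x i ∈ X i) → x ∈ U ∧ ∃ y ∈ L, ∀ i, ‖x i - y i‖ ≤ R

theorem IsGridNear.exists_mem {U L : Set (ι → K)} {N : Set (ι → ℕ)} {R : ℝ} {X : ι → Finset K}
    (hX : IsGridNear U L N R X) {i : ι} {u : K} (hu : u ∈ X i) :
    ∃ x : ι → K, (∀ i, x i ∈ X i) ∧ x i = u := by
  choose x hx using hX.nonempty
  refine ⟨Function.update x i u, fun k => ?_, by simp⟩
  rcases eq_or_ne k i with rfl | hk
  · simpa using hu
  · simpa [hk] using hx k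

/-- Approximation by locally polynomial functions on one polydisc. -/
theorem eventually_exists_isLocallyPolynomial {M : AddSubgroup E}
    (hM : IsOpen (M : Set E)) (hMc : ∀ c : K, ‖c‖ ≤ 1 → ∀ x ∈ M, c • x ∈ M)
    {J : Type*} [Fintype J] [DecidableEq J] (π : ι → J) (r : J → ℕ)
    {U L : Set (ι → K)} (hL : IsCompact L) (hLU : L ⊆ U) (f : U → E) {a : ι → K} {R : ℝ}
    (hR : 0 < R) (hc : IsCartesian (U ∩ polydisc a R))
    (hf : ∀ β ∈ blockSet π r, ∃ g : C(diffDomain (U ∩ polydisc a R) β, E),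
      ExtendsDiffQuot (restr Set.inter_subset_left f) β g) :
    ∀ᶠ ρ in 𝓝[≠] (0 : K), ∃ g, IsLocallyPolynomial ρ g ∧
      ∀ X, IsGridNear U L (blockSet π r) ‖ρ‖ X → (∀ i, ∀ u ∈ X i, ‖u - a i‖ ≤ R) →
        gdq (extZero f - g) X ∈ M := by
  obtain ⟨S, hS, hUS⟩ := hc
  have hSU : Set.univ.pi S ⊆ U := hUS ▸ Set.inter_subset_left
  have hf' : ∀ β ∈ blockSet π r, ∃ g : C(diffDomain (Set.univ.pi S) β, E),
      ExtendsDiffQuot (restr hSU f) β g := by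
    have : ∀ V (hV : V ⊆ U), U ∩ polydisc a R = V → ∀ β ∈ blockSet π r,
        ∃ g : C(diffDomain V β, E), ExtendsDiffQuot (restr hV f) β g := by
      rintro V hV rfl
      exact hf
    exact this _ hSU hUS
  have hLc : IsCompact (L ∩ polydisc a R) := hL.inter_right (by
    rw [polydisc_eq_closedBall a hR.le]
    exact Metric.isClosed_closedBall)
  -- The product of the projections may be larger than `L ∩ polydisc a R`, but it is compact and
  -- still inside the cartesian set `∏ S i`.
  set C : ι → Set K := fun i => (fun x => x i) '' (L ∩ polydisc a R) with hCdef
  have hC : ∀ i, IsCompact (C i) := fun i => hLc.image (continuous_apply i)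
  have hCS : ∀ i, C i ⊆ S i := by
    rintro i _ ⟨x, ⟨hxL, hxa⟩, rfl⟩
    have : x ∈ Set.univ.pi S := hUS ▸ ⟨hLU hxL, hxa⟩
    exact this i (Set.mem_univ i)
  have hvar : ∀ β ∈ blockSet π r, ∀ᶠ ρ in 𝓝[≠] (0 : K), ∀ X Y : ι → Finset K,
      (∀ i, (X i).card = β i + 1) → (∀ i, (Y i).card = β i + 1) →
      (∀ i, ∀ u ∈ X i, u ∈ S i ∧ ∃ t ∈ C i, ‖u - t‖ ≤ ‖ρ‖) →
      (∀ i, ∀ u ∈ Y i, u ∈ S i ∧ ∃ t ∈ C i, ‖u - t‖ ≤ ‖ρ‖) →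
      (∀ i, X i = Y i ∨ ∀ u ∈ X i, ∀ v ∈ Y i, ‖u - v‖ ≤ ‖ρ‖) →
        gdq (extZero f) X - gdq (extZero f) Y ∈ M := by
    intro β hβ
    obtain ⟨R', hR', h⟩ := exists_radius_gdq_sub_mem hM f hSU (hf' β hβ) hC hCS
    filter_upwards [nhdsWithin_le_nhds (Metric.closedBall_mem_nhds (0 : K) hR')] with ρ hρ
    exact h ‖ρ‖ (by simpa using hρ)
  have hsmall : ∀ᶠ ρ in 𝓝[≠] (0 : K), ‖ρ‖ ≤ min R 1 := by
    filter_upwards [nhdsWithin_le_nhds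
      (Metric.closedBall_mem_nhds (0 : K) (lt_min hR one_pos))] with ρ hρ
    rwa [mem_closedBall_zero_iff] at hρ
  filter_upwards [(Filter.eventually_all_finite (finite_blockSet π r)).2 hvar, hsmall,
    self_mem_nhdsWithin] with ρ hρvar hρ hρ0
  have hρR := hρ.trans (min_le_left _ _)
  have hρ1 := hρ.trans (min_le_right _ _)
  -- The part of `S i` within `‖ρ‖` of `C i` is saturated under balls of that radius in `S i`; each
  -- such ball has infinitely many points of `S i`, as there are no isolated ones.
  set G : ι → Set K := fun i => {u | u ∈ S i ∧ ∃ t ∈ C i, ‖u - t‖ ≤ ‖ρ‖} with hGdef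
  obtain ⟨g, hg, hg'⟩ := exists_isLocallyPolynomial (E := E) hMc hρ0 hρ1 (G := G) (h := extZero f)
    (fun i t ht => by
      have hacc := (hS i t ht.1).nhds_inter
        (Metric.closedBall_mem_nhds t (norm_pos_iff.2 hρ0))
      refine (Set.Infinite.of_accPt hacc).mono ?_
      rintro u ⟨hu, huS⟩
      obtain ⟨t', ht', htt'⟩ := ht.2
      refine ⟨⟨huS, t', ht', ?_⟩, hu⟩
      rw [Metric.mem_closedBall, dist_eq_norm] at hu
      exact norm_sub_le_trans hu htt') π r
    (fun j X Y hX hY hXY hXYc => by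
      have hcard : ∀ i, (X i).card = (Y i).card := fun i => by
        by_cases hi : i ∈ Finset.univ.filter fun i => π i = j
        · exact (hXYc i hi).1
        · rw [hXY i hi]
      refine hρvar _ hX.order_mem X Y (fun i => (gridOrder_add_one (hX.nonempty i)).symm)
        (fun i => ?_) hX.subset hY.subset (fun i => ?_)
      · rw [← hcard, gridOrder_add_one (hX.nonempty i)]
      · by_cases hi : i ∈ Finset.univ.filter fun i => π i = j
        · exact Or.inr (hXYc i hi).2
        · exact Or.inl (hXY i hi))
  refine ⟨g, hg, fun X hX hXa => hg' X ⟨hX.nonempty, fun i u hu => ?_, hX.order_mem⟩⟩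
  obtain ⟨x, hx, rfl⟩ := hX.exists_mem hu
  obtain ⟨hxU, y, hyL, hxy⟩ := hX.subset x hx
  have hxS : x ∈ Set.univ.pi S := hUS ▸ ⟨hxU, fun k => hXa k _ (hx k)⟩
  refine ⟨hxS i (Set.mem_univ i), y i, ⟨y, ⟨hyL, fun k => ?_⟩, rfl⟩, hxy i⟩
  refine norm_sub_le_trans (v := x k) ?_ (hXa k _ (hx k))
  rw [norm_sub_rev]
  exact (hxy k).trans hρR

open Classical in
/-- A point of a set, if there is one. -/
def somePoint (S : Set K) : K := if h : S.Nonempty then h.some else 0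

theorem somePoint_mem {S : Set K} (h : S.Nonempty) : somePoint S ∈ S := by
  rw [somePoint, dif_pos h]
  exact h.some_mem

/-- A point of the ball of radius `R` around `t` which depends on the ball only. -/
def ballCenter (R : ℝ) (t : K) : K := somePoint (Metric.closedBall t R)

theorem norm_ballCenter_sub_le {R : ℝ} (hR : 0 ≤ R) (t : K) : ‖ballCenter R t - t‖ ≤ R := by
  rw [← dist_eq_norm]
  exact somePoint_mem ⟨t, Metric.mem_closedBall_self hR⟩

theorem ballCenter_congr {R : ℝ} {t t' : K} (h : ‖t - t'‖ ≤ R) :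
    ballCenter R t = ballCenter R t' := by
  rw [ballCenter, ballCenter, closedBall_eq_of_norm_sub_le h]

/-- Balls of equal radius coincide or are disjoint; keeping one canonical centre per ball of a
finite cover makes distinct centres more than `R` apart. -/
theorem exists_separated_cover {R : ℝ} (hR : 0 < R) {C : Set K} (hC : IsCompact C) :
    ∃ A : Finset K, (∀ a ∈ A, ∀ b ∈ A, a ≠ b → R < ‖a - b‖) ∧ ∀ t ∈ C, ∃ a ∈ A, ‖t - a‖ ≤ R := by
  classical
  obtain ⟨B, -, hB⟩ := hC.elim_nhds_subcover (fun t => Metric.closedBall t R)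
    fun t _ => Metric.closedBall_mem_nhds t hR
  refine ⟨B.image (ballCenter R), ?_, fun t ht => ?_⟩
  · intro a ha b hb hab
    obtain ⟨s, -, rfl⟩ := Finset.mem_image.1 ha
    obtain ⟨t, -, rfl⟩ := Finset.mem_image.1 hb
    by_contra hle
    have := ballCenter_congr (not_lt.1 hle)
    rw [ballCenter_congr (norm_ballCenter_sub_le hR.le s),
      ballCenter_congr (norm_ballCenter_sub_le hR.le t)] at this
    exact hab this
  · obtain ⟨s, hs, hts⟩ := Set.mem_iUnion₂.1 (hB ht)
    rw [Metric.mem_closedBall, dist_eq_norm] at hts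
    refine ⟨_, Finset.mem_image_of_mem _ hs, norm_sub_le_trans hts ?_⟩
    rw [norm_sub_rev]
    exact norm_ballCenter_sub_le hR.le s

theorem sum_gridOrder_le {J : Type*} [Fintype J] [DecidableEq J] {π : ι → J} {r : J → ℕ}
    {β : ι → ℕ} (hβ : β ∈ blockSet π r) : ∑ i, β i ≤ ∑ j, r j := by
  rw [← Finset.sum_fiberwise Finset.univ π β]
  exact Finset.sum_le_sum fun j _ => hβ j

variable [ContinuousSMul K E]

/-- Approximation by polynomials near a compact subset of `U`. -/
theorem exists_polynomialFun_approx {M : AddSubgroup E}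
    (hM : IsOpen (M : Set E)) (hMc : ∀ c : K, ‖c‖ ≤ 1 → ∀ x ∈ M, c • x ∈ M)
    {J : Type*} [Fintype J] [DecidableEq J] (π : ι → J) (r : J → ℕ)
    {U L : Set (ι → K)} (hU : IsLocallyCartesian U) (hL : IsCompact L) (hLU : L ⊆ U) (f : U → E)
    (hf : ∀ V (hV : IsRelOpen V U), IsCartesian V → ∀ β ∈ blockSet π r,
      ∃ g : C(diffDomain V β, E), ExtendsDiffQuot (restr hV.1 f) β g) :
    ∃ R > (0 : ℝ), ∃ p ∈ polynomialFun K ι E, ∀ X, IsGridNear U L (blockSet π r) R X →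
      gdq (extZero f - p) X ∈ M := by
  classical
  obtain ⟨R₀, hR₀, hcart⟩ := exists_radius_isCartesian hU hL hLU
  obtain ⟨ρ₀, hρ₀, hρ₀R⟩ := NormedField.exists_norm_lt K (lt_min hR₀ one_pos)
  have hρ₀1 : ‖ρ₀‖ ≤ 1 := hρ₀R.le.trans (min_le_right _ _)
  have hρ₀0 : ρ₀ ≠ 0 := norm_pos_iff.1 hρ₀
  replace hcart := fun y hy => hcart y hy ‖ρ₀‖ hρ₀ (hρ₀R.le.trans (min_le_left _ _))
  set m := ∑ j, r j with hm
  -- Approximation on the pieces is done with the better accuracy `ρ₀ ^ m M`, which pays in advance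
  -- for passing to grids spread over several polydiscs of radius `‖ρ₀‖`.
  let M' : AddSubgroup E := M.comap (DistribSMul.toAddMonoidHom E (ρ₀⁻¹ ^ m))
  have hM'mem : ∀ e, e ∈ M' ↔ ρ₀⁻¹ ^ m • e ∈ M := fun e => Iff.rfl
  have hM' : IsOpen (M' : Set E) := hM.preimage (continuous_const_smul (ρ₀⁻¹ ^ m))
  have hMc' : ∀ c : K, ‖c‖ ≤ 1 → ∀ x ∈ M', c • x ∈ M' := fun c hc x hx => by
    rw [hM'mem, smul_comm]
    exact hMc c hc _ hx
  obtain ⟨Λ, hΛL, hΛ⟩ := hL.elim_nhds_subcover (fun a => polydisc a ‖ρ₀‖)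
    fun a _ => (isOpen_polydisc a hρ₀).mem_nhds fun i => by simp
  have hev : ∀ a ∈ Λ, ∀ᶠ ρ in 𝓝[≠] (0 : K), ∃ g, IsLocallyPolynomial ρ g ∧
      ∀ X, IsGridNear U L (blockSet π r) ‖ρ‖ X → (∀ i, ∀ u ∈ X i, ‖u - a i‖ ≤ ‖ρ₀‖) →
        gdq (extZero f - g) X ∈ M' := fun a ha =>
    eventually_exists_isLocallyPolynomial hM' hMc' π r hL hLU f hρ₀ (hcart a (hΛL a ha)).2
      (hf _ (hcart a (hΛL a ha)).1 (hcart a (hΛL a ha)).2)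
  have hsmall : ∀ᶠ ρ in 𝓝[≠] (0 : K), ‖ρ‖ ≤ ‖ρ₀‖ := by
    filter_upwards [nhdsWithin_le_nhds (Metric.closedBall_mem_nhds (0 : K) hρ₀)] with ρ hρ
    rwa [mem_closedBall_zero_iff] at hρ
  -- One radius `‖ρ‖ ≤ ‖ρ₀‖` serves all the finitely many polydiscs of the cover.
  obtain ⟨ρ, hρΛ, hρρ₀, hρ0⟩ := (((Filter.eventually_all_finset Λ).2 hev).and
    (hsmall.and self_mem_nhdsWithin)).exists
  have hρ0 : ρ ≠ 0 := hρ0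
  have hρpos : 0 < ‖ρ‖ := norm_pos_iff.2 hρ0
  have hloc : ∀ c : ι → K, ∃ g, IsLocallyPolynomial ρ g ∧
      ∀ X, IsGridNear U L (blockSet π r) ‖ρ‖ X → (∀ i, ∀ u ∈ X i, ‖u - c i‖ ≤ ‖ρ₀‖) →
        gdq (extZero f - g) X ∈ M' := by
    intro c
    by_cases hcL : ∃ y ∈ L, ∀ i, ‖y i - c i‖ ≤ ‖ρ₀‖
    · obtain ⟨y, hyL, hyc⟩ := hcL
      obtain ⟨a, ha, hya⟩ := Set.mem_iUnion₂.1 (hΛ hyL)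
      obtain ⟨g, hg, hg'⟩ := hρΛ a ha
      refine ⟨g, hg, fun X hX hXc => hg' X hX fun i u hu => ?_⟩
      exact norm_sub_le_trans (norm_sub_le_of_norm_sub_le (hXc i u hu) (hyc i)) (hya i)
    -- A polydisc that misses `L` contains no grid near `L`, so any function will do.
    · refine ⟨0, fun c => ⟨0, AddSubgroup.zero_mem _, fun _ _ => rfl⟩, fun X hX hXc => ?_⟩
      choose x hx using hX.nonempty
      obtain ⟨-, y, hyL, hxy⟩ := hX.subset x hx
      refine absurd ⟨y, hyL, fun i => ?_⟩ hcL
      refine norm_sub_le_trans (v := x i) ?_ (hXc i _ (hx i))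
      rw [norm_sub_rev]
      exact (hxy i).trans hρρ₀
  choose g hg hg' using hloc
  -- Glue by using, at `x`, the approximant attached to the canonical centre of its polydisc of
  -- radius `‖ρ₀‖`. This choice is constant on the smaller polydiscs of radius `‖ρ‖`, so `G` remains
  -- locally polynomial.
  let G : (ι → K) → E := fun x => g (fun i => ballCenter ‖ρ₀‖ (x i)) x
  have hG : IsLocallyPolynomial ρ G := by
    intro c
    obtain ⟨p, hp, hp'⟩ := hg (fun i => ballCenter ‖ρ₀‖ (c i)) c
    refine ⟨p, hp, fun x hx => ?_⟩
    have : (fun i => ballCenter ‖ρ₀‖ (x i)) = fun i => ballCenter ‖ρ₀‖ (c i) :=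
      funext fun i => ballCenter_congr ((hx i).trans hρρ₀)
    simp only [G, this]
    exact hp' x hx
  have hfG : ∀ X, IsGridNear U L (blockSet π r) ‖ρ‖ X → gdq (extZero f - G) X ∈ M := by
    intro X hX
    refine smul_pow_inv_mem hMc hρ₀0 hρ₀1 (gdq_mem_of_local hMc hρ₀0 (B := Finset.univ) (r := m)
      (Q := IsGridNear U L (blockSet π r) ‖ρ‖) (fun X hX => hX.nonempty)
      (fun X Y hX hYX hY => ⟨hY, isLowerSet_blockSet π r (gridOrder_mono hYX) hX.order_mem,
        fun x hx => hX.subset x fun i => hYX i (hx i)⟩)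
      (fun X hX => sum_gridOrder_le hX.order_mem) (fun X hX hl => ?_) X hX)
    choose x hx using hX.nonempty
    have hxc : ∀ i, ∀ u ∈ X i, ballCenter ‖ρ₀‖ u = ballCenter ‖ρ₀‖ (x i) := fun i u hu =>
      ballCenter_congr (hl i (Finset.mem_univ i) u hu (x i) (hx i))
    have h1 := hg' (fun i => ballCenter ‖ρ₀‖ (x i)) X hX fun i u hu => by
      rw [← hxc i u hu, norm_sub_rev]
      exact norm_ballCenter_sub_le hρ₀.le u
    have h2 : gdq (extZero f - G) X =
        gdq (extZero f - g fun i => ballCenter ‖ρ₀‖ (x i)) X := by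
      refine gdq_congr fun y hy => ?_
      have : (fun i => ballCenter ‖ρ₀‖ (y i)) = fun i => ballCenter ‖ρ₀‖ (x i) :=
        funext fun i => hxc i _ (hy i)
      simp only [Pi.sub_apply, G, this]
    rw [h2]
    rw [hM'mem] at h1
    -- Membership in `M'` has weight `ρ₀⁻¹ ^ m`; multiplying by `ρ₀ ^ |order|` leaves exactly the
    -- weight required for gluing.
    have h3 := hMc (ρ₀ ^ (∑ i, gridOrder X i)) (by
      rw [norm_pow]
      exact pow_le_one₀ (norm_nonneg _) hρ₀1) _ h1
    have hle : ∑ i, gridOrder X i ≤ m := sum_gridOrder_le hX.order_mem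
    have e : ρ₀⁻¹ ^ (m - ∑ i, gridOrder X i) = ρ₀ ^ (∑ i, gridOrder X i) * ρ₀⁻¹ ^ m := by
      conv_rhs => rw [← Nat.sub_add_cancel hle, pow_add, mul_comm, mul_assoc, ← mul_pow,
        inv_mul_cancel₀ hρ₀0, one_pow, mul_one]
    rw [e, ← smul_smul]
    exact h3
  choose A hA hAL using fun i => exists_separated_cover hρpos (hL.image (continuous_apply i))
  obtain ⟨p, hp, hp'⟩ := hG.exists_polynomialFun (hM.mem_nhds M.zero_mem) hρ0
    (hρρ₀.trans hρ₀1) hA m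
  refine ⟨‖ρ‖, hρpos, p, hp, fun X hX => ?_⟩
  have h1 := hp' X hX.nonempty (fun i => by
    rw [← gridOrder_add_one (hX.nonempty i)]
    have h2 : gridOrder X i ≤ ∑ i, gridOrder X i :=
      Finset.single_le_sum (f := gridOrder X) (fun _ _ => Nat.zero_le _) (Finset.mem_univ i)
    have h3 := sum_gridOrder_le hX.order_mem
    omega) fun i u hu => by
      obtain ⟨x, hx, rfl⟩ := hX.exists_mem hu
      obtain ⟨-, y, hyL, hxy⟩ := hX.subset x hx
      obtain ⟨a, ha, hya⟩ := hAL i (y i) ⟨y, hyL, rfl⟩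
      exact ⟨a, ha, norm_sub_le_trans (hxy i) hya⟩
  have := M.add_mem (hfG X hX) h1
  rwa [← gdq_add, sub_add_sub_cancel] at this

end Compactness

/-! ### Density in the function spaces. -/

section Density

variable {K : Type*} [NontriviallyNormedField K] [IsUltrametricDist K]
variable {ι : Type*} [Fintype ι] [DecidableEq ι]
variable {E : Type*} [AddCommGroup E] [Module K E] [TopologicalSpace E]
  [IsTopologicalAddGroup E] [ContinuousSMul K E]

/-- A compact subset of a domain `V^{<β>}` with `β ∈ N`. -/
structure CompactPiece (U : Set (ι → K)) (N : Set (ι → ℕ)) where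
  /-- A relatively open cartesian subset of `U`. -/
  dom : Set (ι → K)
  /-- The order of the difference quotients. -/
  order : ι → ℕ
  /-- The compact set. -/
  comp : Set (diffDomain dom order)
  relOpen : IsRelOpen dom U
  cartesian : IsCartesian dom
  order_mem : order ∈ N
  compact : IsCompact comp

/-- The extended difference quotients of `f` and `p` differ by elements of `M` on `s`. -/
def CompactPiece.Close {U : Set (ι → K)} {N : Set (ι → ℕ)} (s : CompactPiece U N)
    (M : AddSubgroup E) (f p : U → E) : Prop :=
  ∀ gf gp : C(diffDomain s.dom s.order, E), ExtendsDiffQuot (restr s.relOpen.1 f) s.order gf →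
    ExtendsDiffQuot (restr s.relOpen.1 p) s.order gp → ∀ y ∈ s.comp, gf y - gp y ∈ M

/-- The multi-indices with `|β_j| ≤ α j` for each block of coordinates. -/
def blockSetTop {J : Type*} [DecidableEq J] (π : ι → J) (α : J → ℕ∞) : Set (ι → ℕ) :=
  {β | ∀ j, ((∑ i with π i = j, β i : ℕ) : ℕ∞) ≤ α j}

/-- Collect all points entering the given compact pieces into one compact `L ⊆ U` and approximate
near `L`. A neighbourhood of `L` is needed because points of the pieces may have repeated entries
and are reached only as limits of grids. -/
theorem exists_isPol_close {M : AddSubgroup E}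
    (hM : IsOpen (M : Set E)) (hMc : ∀ c : K, ‖c‖ ≤ 1 → ∀ x ∈ M, c • x ∈ M)
    {J : Type*} [Fintype J] [DecidableEq J] (π : ι → J) (α : J → ℕ∞)
    {U : Set (ι → K)} (hU : IsLocallyCartesian U) (f : U → E)
    (hf : ∀ V (hV : IsRelOpen V U), IsCartesian V → ∀ β ∈ blockSetTop π α,
      ∃ g : C(diffDomain V β, E), ExtendsDiffQuot (restr hV.1 f) β g)
    {T : Set (CompactPiece U (blockSetTop π α))} (hT : T.Finite) :
    ∃ p : U → E, IsPol p ∧ ∀ s ∈ T, s.Close M f p := by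
  classical
  lift T to Finset (CompactPiece U (blockSetTop π α)) using hT
  -- Infinite entries of `α` disappear here: finitely many pieces involve only bounded orders.
  let r : J → ℕ := fun j => T.sup fun s => ∑ i with π i = j, s.order i
  have hr : ∀ s ∈ T, s.order ∈ blockSet π r := fun s hs j =>
    Finset.le_sup (f := fun s : CompactPiece U (blockSetTop π α) => ∑ i with π i = j, s.order i) hs
  have hrα : blockSet π r ⊆ blockSetTop π α := fun β hβ j => by
    refine le_trans (Nat.cast_le.2 (hβ j)) ?_
    refine Finset.sup_induction (p := fun n : ℕ => (n : ℕ∞) ≤ α j) (by simp) ?_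
      fun s _ => s.order_mem j
    intro m hm n hn
    rcases max_choice m n with h | h <;> rw [h] <;> assumption
  let ev : ∀ s : CompactPiece U (blockSetTop π α), ((i : ι) → Fin (s.order i + 1)) →
      diffDomain s.dom s.order → ι → K := fun s j y i => y.1 i (j i)
  have hev : ∀ s j, Continuous (ev s j) := fun s j => continuous_pi fun i =>
    (continuous_apply (j i)).comp ((continuous_apply i).comp continuous_subtype_val)
  let L : Set (ι → K) := ⋃ s ∈ T, ⋃ j, ev s j '' s.comp
  have hL : IsCompact L := T.isCompact_biUnion fun s _ => isCompact_iUnion fun j =>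
    s.compact.image (hev s j)
  have hLU : L ⊆ U := by
    intro x hx
    simp only [L, Set.mem_iUnion] at hx
    obtain ⟨s, -, j, y, -, rfl⟩ := hx
    exact s.relOpen.1 (y.2 j)
  obtain ⟨R, hR, p, hp, hfp⟩ := exists_polynomialFun_approx hM hMc π r hU hL hLU f
    fun V hV hc β hβ => hf V hV hc β (hrα hβ)
  refine ⟨fun x => p x, ?_, fun s hs gf gp hgf hgp y hy => ?_⟩
  · obtain ⟨a, ha⟩ := exists_finsupp_of_mem_polynomialFun hp
    exact ⟨a, fun x => ha x⟩
  · by_contra hyM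
    -- Open subgroups are closed, so a failure at `y` would persist at a nearby point with pairwise
    -- distinct entries, where the extensions are divided differences.
    have hclosed : IsClosed {z | gf z - gp z ∈ M} :=
      (M.isClosed_of_isOpen hM).preimage (gf.continuous.sub gp.continuous)
    obtain ⟨O, hO, hOeq⟩ := isOpen_induced_iff.1 hclosed.isOpen_compl
    have hyO : y.1 ∈ O := by
      have : y ∈ Subtype.val ⁻¹' O := by rw [hOeq]; exact hyM
      exact this
    obtain ⟨x, ⟨hxO, hxy⟩, hx⟩ := mem_closure_iff_nhds.1
      (diffDomain_subset_closure s.cartesian s.order y.2) _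
      (Filter.inter_mem (hO.mem_nhds hyO) (Metric.closedBall_mem_nhds y.1 hR))
    have hxM : gf ⟨x, hx.1⟩ - gp ⟨x, hx.1⟩ ∉ M := by
      have : (⟨x, hx.1⟩ : diffDomain s.dom s.order) ∈ Subtype.val ⁻¹' O := hxO
      rw [hOeq] at this
      exact this
    refine hxM ?_
    rw [hgf ⟨x, hx⟩, hgp ⟨x, hx⟩, diffQuot_restr, diffQuot_restr]
    have hgrid : ∀ z : ι → K, (∀ i, z i ∈ Finset.univ.image (x i)) →
        ∃ j : (i : ι) → Fin (s.order i + 1), z = fun i => x i (j i) := by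
      intro z hz
      simp only [Finset.mem_image, Finset.mem_univ, true_and] at hz
      choose j hj using hz
      exact ⟨j, funext fun i => (hj i).symm⟩
    have hnear : IsGridNear U L (blockSet π r) R fun i => Finset.univ.image (x i) := by
      refine ⟨fun i => Finset.univ_nonempty.image _, ?_, fun z hz => ?_⟩
      · convert hr s hs using 1
        ext1 i
        rw [gridOrder, Finset.card_image_of_injective _ (hx.2 i)]
        simp
      · obtain ⟨j, rfl⟩ := hgrid z hz
        refine ⟨s.relOpen.1 (hx.1 j), ev s j y, ?_, fun i => ?_⟩
        · simp only [L, Set.mem_iUnion]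
          exact ⟨s, hs, j, y, hy, rfl⟩
        · rw [← dist_eq_norm]
          exact ((dist_le_pi_dist (x i) (y.1 i) (j i)).trans (dist_le_pi_dist x y.1 i)).trans hxy
    have h1 := hfp _ hnear
    rw [gdq_sub] at h1
    have h2 := gdq_congr (f := extZero fun x : U => p x) (g := p) fun z hz =>
      extZero_of_mem (fun x : U => p x) (hnear.subset z hz).1
    rw [← h2] at h1
    exact h1

/-- Common to both kinds of function spaces: `htop` says that closeness on compact pieces forces
convergence to `f`. A basic set involves finitely many pieces and subgroups, and intersecting the
subgroups reduces to `exists_isPol_close`. -/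
theorem mem_closure_isPol (hE : IsLocallyConvex K E)
    {J : Type*} [Fintype J] [DecidableEq J] (π : ι → J) (α : J → ℕ∞)
    {U : Set (ι → K)} (hU : IsLocallyCartesian U) {X : Type*} [TopologicalSpace X]
    (toFun : X → U → E) (hpol : ∀ p, IsPol p → ∃ x, toFun x = p) (f : X)
    (hf : ∀ V (hV : IsRelOpen V U), IsCartesian V → ∀ β ∈ blockSetTop π α,
      ∃ g : C(diffDomain V β, E), ExtendsDiffQuot (restr hV.1 (toFun f)) β g)
    (htop : ∀ F : Filter X, (∀ (s : CompactPiece U (blockSetTop π α)) (M : AddSubgroup E),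
      IsOpen (M : Set E) → ∀ᶠ x in F, s.Close M (toFun f) (toFun x)) → F ≤ 𝓝 f) :
    f ∈ closure {x | IsPol (toFun x)} := by
  let I := CompactPiece U (blockSetTop π α) ×
    {M : AddSubgroup E // IsOpen (M : Set E) ∧ ∀ c : K, ‖c‖ ≤ 1 → ∀ x ∈ M, c • x ∈ M}
  let S : I → Set X := fun i => {x | i.1.Close i.2.1 (toFun f) (toFun x)}
  have hF : (⨅ i, Filter.principal (S i)) ≤ 𝓝 f := by
    refine htop _ fun s M hM => ?_
    obtain ⟨M', hM', hMc', hMM⟩ := hE M (hM.mem_nhds M.zero_mem)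
    refine Filter.mem_of_superset (Filter.mem_iInf_of_mem
      (⟨s, M', hM', hMc'⟩ : I) (Filter.mem_principal_self _)) ?_
    exact fun x hx gf gp hgf hgp y hy => hMM (hx gf gp hgf hgp y hy)
  rw [mem_closure_iff_nhds]
  intro t ht
  obtain ⟨T, hT, hTt⟩ := (Filter.hasBasis_iInf_principal_finite S).mem_iff.1 (hF ht)
  let M : AddSubgroup E := ⨅ i ∈ T, i.2.1
  have hMmem : ∀ e, e ∈ M ↔ ∀ i ∈ T, e ∈ i.2.1 := fun e => by simp [M, AddSubgroup.mem_iInf]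
  have hM : IsOpen (M : Set E) := by
    have : (M : Set E) = ⋂ i ∈ T, (i.2.1 : Set E) := by
      ext e
      rw [SetLike.mem_coe, hMmem]
      simp
    rw [this]
    exact hT.isOpen_biInter fun i _ => i.2.2.1
  obtain ⟨p, hp, hpc⟩ := exists_isPol_close hM (fun c hc x hx => (hMmem _).2 fun i hi =>
    i.2.2.2 c hc x ((hMmem x).1 hx i hi)) π α hU (toFun f) hf (hT.image Prod.fst)
  obtain ⟨x, rfl⟩ := hpol p hp
  refine ⟨x, hTt (Set.mem_iInter₂.2 fun i hi gf gp hgf hgp y hy => ?_), hp⟩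
  exact (hMmem _).1 (hpc i.1 ⟨i, hi, rfl⟩ gf gp hgf hgp y hy) i hi

/-- Convergence of the extended difference quotients in the compact-open topology. -/
theorem tendsto_of_eventually_close (hE : IsLocallyConvex K E) {U : Set (ι → K)} {N : Set (ι → ℕ)}
    {X : Type*} {F : Filter X} (toFun : X → U → E) (f : U → E) {V : Set (ι → K)}
    (hV : IsRelOpen V U) (hc : IsCartesian V) {β : ι → ℕ} (hβ : β ∈ N)
    (h : ∀ (s : CompactPiece U N) (M : AddSubgroup E), IsOpen (M : Set E) →
      ∀ᶠ x in F, s.Close M f (toFun x))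
    (ext : X → C(diffDomain V β, E))
    (hext : ∀ x, ExtendsDiffQuot (restr hV.1 (toFun x)) β (ext x))
    (g : C(diffDomain V β, E)) (hg : ExtendsDiffQuot (restr hV.1 f) β g) :
    Filter.Tendsto ext F (𝓝 g) := by
  rw [ContinuousMap.tendsto_nhds_compactOpen]
  intro C hC O hO hCO
  -- Compactness of `g(C)` gives one zero-neighbourhood `W` with `W + g(C) ⊆ O`.
  obtain ⟨W, hW, hWO⟩ := compact_open_separated_add_left (hC.image g.continuous) hO
    (Set.image_subset_iff.2 hCO)
  obtain ⟨M, hM, -, hMW⟩ := hE W hW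
  filter_upwards [h ⟨V, β, C, hV, hc, hβ, hC⟩ M hM] with x hx y hy
  have h1 := M.neg_mem (hx g (ext x) hg (hext x) y hy)
  rw [neg_sub] at h1
  have := hWO (Set.add_mem_add (hMW h1) (Set.mem_image_of_mem g hy))
  rwa [sub_add_cancel] at this

theorem blockSetTop_mono {J : Type*} [DecidableEq J] {π : ι → J} {α : J → ℕ∞} {β γ : ι → ℕ}
    (hβ : β ∈ blockSetTop π α) (h : ∀ i, γ i ≤ β i) : γ ∈ blockSetTop π α := fun j =>
  le_trans (Nat.cast_le.2 (Finset.sum_le_sum fun i _ => h i)) (hβ j)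

theorem IsPol.isC {U : Set (ι → K)} {p : U → E} (hp : IsPol p) (α : ι → ℕ∞) : IsC α p :=
  fun _ hV _ β _ => hp.exists_extendsDiffQuot hV.1 β

theorem IsPol.isCOn {U : Set (ι → K)} {p : U → E} (hp : IsPol p) (N : Set (ι → ℕ)) :
    IsCOn N p := fun _ _ => hp.isC _

theorem dense_isPol_cSpaceOn (hE : IsLocallyConvex K E) {J : Type*} [Fintype J] [DecidableEq J]
    (π : ι → J) (α : J → ℕ∞) {U : Set (ι → K)} (hU : IsLocallyCartesian U) :
    Dense {f : CSpaceOn (blockSetTop π α) U E | IsPol f.1} := by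
  intro f
  refine mem_closure_isPol hE π α hU (fun f : CSpaceOn (blockSetTop π α) U E => f.1)
    (fun p hp => ⟨⟨p, hp.isCOn _⟩, rfl⟩) f
    (fun V hV hc β hβ => f.2 β hβ V hV hc β fun _ => le_rfl) fun F hF => ?_
  simp only [nhds_iInf, nhds_induced, Filter.comap_iInf, Filter.comap_comap, le_iInf_iff]
  intro β hβ V hV hc γ hγ
  refine Filter.tendsto_iff_comap.1 ?_
  exact tendsto_of_eventually_close hE (fun f : CSpaceOn (blockSetTop π α) U E => f.1) f.1 hV hc
    (blockSetTop_mono hβ fun i => Nat.cast_le.1 (hγ i)) hF _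
    (fun x => ((x.2 β hβ) V hV hc γ hγ).choose_spec) _ ((f.2 β hβ) V hV hc γ hγ).choose_spec

theorem mem_blockSetTop_id {α : ι → ℕ∞} {β : ι → ℕ} :
    β ∈ blockSetTop (id : ι → ι) α ↔ ∀ i, (β i : ℕ∞) ≤ α i := by
  simp [blockSetTop, Finset.filter_eq']

/-- The case of blocks with a single coordinate, where the condition on block sums is `β ≤ α`. -/
theorem dense_isPol_cSpace (hE : IsLocallyConvex K E) (α : ι → ℕ∞) {U : Set (ι → K)}
    (hU : IsLocallyCartesian U) : Dense {f : CSpace α U E | IsPol f.1} := by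
  intro f
  refine mem_closure_isPol hE id α hU (fun f : CSpace α U E => f.1)
    (fun p hp => ⟨⟨p, hp.isC _⟩, rfl⟩) f
    (fun V hV hc β hβ => f.2 V hV hc β (mem_blockSetTop_id.1 hβ)) fun F hF => ?_
  simp only [nhds_iInf, nhds_induced, le_iInf_iff]
  intro V hV hc γ hγ
  refine Filter.tendsto_iff_comap.1 ?_
  exact tendsto_of_eventually_close hE (fun f : CSpace α U E => f.1) f.1 hV hc
    (mem_blockSetTop_id.2 hγ) hF _
    (fun x => (x.2 V hV hc γ hγ).choose_spec) _ (f.2 V hV hc γ hγ).choose_spec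

end Density

/-! ### The index sets of the theorem as instances of one block condition. -/

theorem blockIndices_eq_blockSetTop {ℓ : ℕ} (n : Fin ℓ → ℕ) (α : Fin ℓ → ℕ∞) :
    blockIndices n α = blockSetTop (Sigma.fst : BlockIndex n → Fin ℓ) α := by
  ext β
  have : ∀ j, ∑ i : BlockIndex n with i.1 = j, β i = ∑ k, β ⟨j, k⟩ := fun j => by
    rw [Finset.sum_filter, Fintype.sum_sigma, Finset.sum_eq_single j]
    · simp
    · intro b _ hb
      simp [hb]
    · simp
  simp only [blockIndices, blockSetTop, Set.mem_ofPred_eq, this]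

theorem totalIndices_eq_blockSetTop (n : ℕ) (r : ℕ∞) :
    totalIndices n r = blockSetTop (fun _ : Fin n => ()) fun _ => r := by
  ext β
  simp [totalIndices, blockSetTop]

end CAlpha

end

theorem mainTheorem10 {K : Type*} [NontriviallyNormedField K] [IsUltrametricDist K]
    [CompleteSpace K] {E : Type*} [AddCommGroup E] [Module K E] [TopologicalSpace E]
    [IsTopologicalAddGroup E] [ContinuousSMul K E] [T2Space E] (hE : IsLocallyConvex K E) :
    (∀ (ℓ : ℕ) (n : Fin ℓ → ℕ), 0 < ℓ → (∀ j, 0 < n j) →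
      ∀ U : Set (BlockIndex n → K), IsLocallyClosed U → IsLocallyCartesian U →
      ∀ α : Fin ℓ → ℕ∞,
        (∀ p : U → E, IsPol p → IsCOn (blockIndices n α) p) ∧
        Dense {f : CSpaceOn (blockIndices n α) U E | IsPol f.1}) ∧
    (∀ n : ℕ, 0 < n →
      ∀ U : Set (Fin n → K), IsLocallyClosed U → IsLocallyCartesian U →
        (∀ r : ℕ∞,
          (∀ p : U → E, IsPol p → IsCOn (totalIndices n r) p) ∧
          Dense {f : CSpaceOn (totalIndices n r) U E | IsPol f.1}) ∧
        (∀ α : Fin n → ℕ∞,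
          (∀ p : U → E, IsPol p → IsC α p) ∧
          Dense {f : CSpace α U E | IsPol f.1})) := by
  refine ⟨fun ℓ n _ _ U _ hU α => ⟨fun p hp => hp.isCOn _, ?_⟩, fun n _ U _ hU =>
    ⟨fun r => ⟨fun p hp => hp.isCOn _, ?_⟩, fun α =>
      ⟨fun p hp => hp.isC α, dense_isPol_cSpace hE α hU⟩⟩⟩
  · rw [blockIndices_eq_blockSetTop]
    exact dense_isPol_cSpaceOn hE _ α hU
  · rw [totalIndices_eq_blockSetTop]
    exact dense_isPol_cSpaceOn hE _ _ hU
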